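/- All manifolds are smooth real Banach manifolds (the model space may vary from chart to chart, and no separation axiom is required). A *Hermitian bundle* $\Pi\colon D\to Z$ is a smooth complex Banach vector bundle over a Banach manifold $Z$ whose fibers $D_z$ are complex Hilbert spaces, with scalar products $(\cdot\mid\cdot)_z$ (linear in the first variable) that depend smoothly on $z$ in local trivializations. Let $\mathbf{Herm}$ be the category of Hermitian bundles, whose morphisms $\Theta=(\delta,\zeta)\colon\Pi_1\to\Pi_2$ are the pairs of smooth maps $\delta\colon D_1\to D_2$, $\zeta\colon Z_1\to Z_2$ with $\Pi_2\circ\delta=\zeta\circ\Pi_1$ such that every $\delta_z:=\delta|_{(D_1)_z}\colon (D_1)_z\to (D_2)_{\zeta(z)}$ is an invertible bounded complex linear operator. Let $\mathbf{Hilb}$ be the category of complex Hilbert spaces and linear isometries. *Kernels.* A kernel on $\Pi$ is a family of bounded operators $K(s,t)\colon D_t\to D_s$ ($s,t\in Z$) with $\sum_{j,l}(K(t_l,t_j)\eta_j\mid\eta_l)_{t_l}\ge0$ for all finite families $\eta_j\in D_{t_j}$. For $\xi\in D$ let $K_\xi=K(\cdot,\Pi(\xi))\xi$, and let $\mathcal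 H^K$ be the Hilbert space completion of $\mathrm{span}\{K_\xi\mid\xi\in D\}$ for $(K_\xi\mid K_\eta)=(K(\Pi(\eta),\Pi(\xi))\xi\mid\eta)_{\Pi(\eta)}$. Let $\mathrm{Gr}(\mathcal H)$ be the Banach manifold of all closed linear subspaces of a complex Hilbert space $\mathcal H$, and put $\zeta_K(s)=\overline{\{K_\xi\mid\xi\in D_s\}}\in\mathrm{Gr}(\mathcal H^K)$. The kernel $K$ is *admissible* if it is a smooth section of the bundle $\mathrm{Hom}(p_2^*\Pi,p_1^*\Pi)\to Z\times Z$ (where $p_1,p_2\colon Z\times Z\to Z$ are the projections), every $K(s,s)$ is invertible, and $\zeta_K\colon Z\to\mathrm{Gr}(\mathcal H^K)$ is smooth. The objects of the category $\mathbf{Kernh}$ are the admissible kernels on Hermitian bundles; its morphisms $K_1\to K_2$ are the $\Theta=(\delta,\zeta)\in\mathrm{Hom}_{\mathbf{Herm}}(\Pi_1,\Pi_2)$ with $K_1(s,t)=\delta_s^*K_2(\zeta(s),\zeta(t))\delta_t$ for all $s,t$. *Connections.* A *linear connection* on $\Pi\colon D\to Z$ is a smooth map $\Phi\colon TD\to TD$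 that is an endomorphism of the vector bundle $TD\to D$, satisfies $\Phi\circ\Phi=\Phi$ and $\mathrm{Ran}\,\Phi_\xi=\mathrm{Ker}\,T_\xi\Pi$ for every $\xi\in D$, and is (complex) linear on the fibers of $T\Pi\colon TD\to TZ$. The objects of the category $\mathbf{LinConnect}$ are the linear connections on Hermitian bundles; its morphisms $\Phi_1\to\Phi_2$ are the $\Theta=(\delta,\zeta)\in\mathrm{Hom}_{\mathbf{Herm}}(\Pi_1,\Pi_2)$ with $\Phi_1=\Theta^*(\Phi_2)$, that is, $T\delta\circ\Phi_1=\Phi_2\circ T\delta$. Let $\mathbb F$ denote the forgetful functors $\mathbf{Kernh}\to\mathbf{Herm}$ and $\mathbf{LinConnect}\to\mathbf{Herm}$. *Universal objects.* For a complex Hilbert space $\mathcal H$ let $\Pi_{\mathcal H}\colon\mathcal T(\mathcal H)=\{(\mathcal S,x)\mid x\in\mathcal S\}\to\mathrm{Gr}(\mathcal H)$ be the tautological bundle with the scalar product of $\mathcal H$, and let $Q_{\mathcal H}(\mathcal S_1,\mathcal S_2)=p_{\mathcal S_1}|_{\mathcal S_2}$ be the universal kernel, where $p_{\mathcal S}$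 is the orthogonal projection onto $\mathcal S$. The universal connection $\Phi_{\mathcal H}$ is the linear connection on $\Pi_{\mathcal H}$ that maps the velocity at $t=0$ of $t\mapsto(u e^{tX}\mathcal S_0,\,u e^{tX}(x+ty))$ to the velocity at $t=0$ of $t\mapsto(u e^{tE_p(X)}\mathcal S_0,\,u e^{tE_p(X)}(x+ty))$, for every unitary $u$, every skew-adjoint bounded operator $X$, every $\mathcal S_0\in\mathrm{Gr}(\mathcal H)$ and all $x,y\in\mathcal S_0$, where $p=p_{\mathcal S_0}$ and $E_p(X)=pXp+(1-p)X(1-p)$. A linear isometry $V\colon\mathcal H\to\mathcal H'$ induces the morphism $(\mathcal S,x)\mapsto(V\mathcal S,Vx)$ from $\Pi_{\mathcal H}$ to $\Pi_{\mathcal H'}$. **Theorem.** The universal kernels $Q_{\mathcal H}$ are admissible and the universal connections $\Phi_{\mathcal H}$ exist; with the morphisms induced by isometries, they define functors $\mathcal Q\colon\mathbf{Hilb}\to\mathbf{Kernh}$ and $\Phi\colon\mathbf{Hilb}\to\mathbf{LinConnect}$. For every admissible kernel $K$ on a Hermitian bundle $\Pi\colon D\to Z$ the pair $\Delta_K=(\delta_K,\zeta_K)$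 with $\delta_K(\xi)=(\zeta_K(\Pi(\xi)),K_\xi)$ is a morphism $\Pi\to\Pi_{\mathcal H^K}$ in $\mathbf{Herm}$, and $K\mapsto\Phi_K:=\Delta_K^*(\Phi_{\mathcal H^K})$, acting identically on morphisms, defines a functor $\mathbb A\colon\mathbf{Kernh}\to\mathbf{LinConnect}$. This functor satisfies $\mathbb F\circ\mathbb A=\mathbb F$ and $\mathbb A\circ\mathcal Q=\Phi$, and it is the only functor $\mathbf{Kernh}\to\mathbf{LinConnect}$ with these two properties. -/

import Mathlib

open scoped ContDiff ComplexOrder InnerProductSpace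
open CategoryTheory

universe u

noncomputable section

/-! ### Banach manifolds -/

/-- A smooth real Banach manifold in the sense of an atlas on a set: a family of bijections
`chart x` (indexed by the points, with `x` in the domain of `chart x`) from subsets of `M` onto
subsets of Banach spaces, such that overlaps have open images and the transition maps are smooth.
The model space may vary from chart to chart, and the topology is the one in which a set is open
iff its images in all the charts are open. -/
class BanachManifold (M : Type u) where
  Model : M → Type u
  [normedAddCommGroup : ∀ x, NormedAddCommGroup (Model x)]
  [normedSpace : ∀ x, NormedSpace ℝ (Model x)]
  [completeSpace : ∀ x, CompleteSpace (Model x)]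
  chart : ∀ x, PartialEquiv M (Model x)
  mem_source : ∀ x, x ∈ (chart x).source
  isOpen_overlap : ∀ x y,
    IsOpen ((chart x).target ∩ (chart x).symm ⁻¹' (chart y).source)
  contDiffOn_overlap : ∀ x y,
    ContDiffOn ℝ ∞ (chart y ∘ (chart x).symm)
      ((chart x).target ∩ (chart x).symm ⁻¹' (chart y).source)

attribute [reducible, instance] BanachManifold.normedAddCommGroup BanachManifold.normedSpace
attribute [instance] BanachManifold.completeSpace

namespace BanachManifold

variable {M N P : Type u} [BanachManifold M] [BanachManifold N] [BanachManifold P]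

/-- The image of `s` under the chart at `x`, a subset of the model space at `x`. -/
def chartImage (x : M) (s : Set M) : Set (Model x) :=
  (chart x).target ∩ (chart x).symm ⁻¹' s

/-- Open subsets of a Banach manifold. -/
def IsOpenSet (s : Set M) : Prop := ∀ x : M, IsOpen (chartImage x s)

/-- Smooth maps: in any pair of charts the domain of the local representative is open, and the
local representative is smooth on it. -/
def IsSmooth (f : M → N) : Prop :=
  ∀ (x : M) (y : N),
    IsOpen (chartImage x (f ⁻¹' (chart y).source)) ∧
    ContDiffOn ℝ ∞ (chart y ∘ f ∘ (chart x).symm) (chartImage x (f ⁻¹' (chart y).source))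

/-- The tangent space at `x`, realized in the chart at `x`. -/
abbrev TangentSp (x : M) : Type u := Model x

/-- The tangent map `T_x f : T_x M → T_{f x} N`. -/
def tmap (f : M → N) (x : M) : TangentSp x →L[ℝ] TangentSp (f x) :=
  fderiv ℝ (chart (f x) ∘ f ∘ (chart x).symm) (chart x x)

/-- The velocity at time `0`, as a vector in `T_x M`, of a curve `γ` with `γ 0 = x`. -/
def velocity (x : M) (γ : ℝ → M) : TangentSp x := deriv (fun t => chart x (γ t)) 0

/-- The tangent map at `y` of the chart at `a` (for `y` in the domain of that chart). -/
def tchart (a y : M) : TangentSp y →L[ℝ] Model a :=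
  fderiv ℝ (chart a ∘ (chart y).symm) (chart y y)

/-- The inverse of the tangent map at `y` of the chart at `a`. -/
def tchartSymm (a y : M) : Model a →L[ℝ] TangentSp y :=
  fderiv ℝ (chart y ∘ (chart a).symm) (chart a y)

/-- A family of bounded operators on the tangent spaces is a smooth map `TM → TM` iff its
representative in each chart of `TM` is smooth. -/
def IsSmoothTangentEndo (Φ : ∀ x : M, TangentSp x →L[ℝ] TangentSp x) : Prop :=
  ∀ a : M, ContDiffOn ℝ ∞
    (fun q : Model a × Model a =>
      tchart a ((chart a).symm q.1)
        (Φ ((chart a).symm q.1) (tchartSymm a ((chart a).symm q.1) q.2)))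
    ((chart a).target ×ˢ Set.univ)

lemma isOpen_target (x : M) : IsOpen (chart x).target := by
  have h := isOpen_overlap x x
  have e : (chart x).target ∩ (chart x).symm ⁻¹' (chart x).source = (chart x).target := by
    apply Set.inter_eq_left.2
    intro p hp
    exact (chart x).map_target hp
  rwa [e] at h

lemma isSmooth_id : IsSmooth (id : M → M) := fun x y =>
  ⟨isOpen_overlap x y, contDiffOn_overlap x y⟩

lemma chart_mem_chartImage (x : M) (s : Set M) (h : x ∈ s) : chart x x ∈ chartImage x s := by
  refine ⟨(chart x).map_source (mem_source x), ?_⟩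
  rw [Set.mem_preimage, (chart x).left_inv (mem_source x)]
  exact h

lemma IsSmooth.comp {g : N → P} {f : M → N} (hg : IsSmooth g) (hf : IsSmooth f) :
    IsSmooth (g ∘ f) := by
  intro x z
  have key : ∀ p ∈ chartImage x ((g ∘ f) ⁻¹' (chart z).source),
      ∃ V : Set (Model x), IsOpen V ∧ p ∈ V ∧
        V ⊆ chartImage x ((g ∘ f) ⁻¹' (chart z).source) ∧
        ContDiffOn ℝ ∞ (chart z ∘ (g ∘ f) ∘ (chart x).symm) V := by
    intro p hp
    set y := f ((chart x).symm p) with hy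
    have hA := hf x y
    have hB := hg y z
    set A := chartImage x (f ⁻¹' (chart y).source)
    set B := chartImage y (g ⁻¹' (chart z).source)
    refine ⟨A ∩ (chart y ∘ f ∘ (chart x).symm) ⁻¹' B,
      hA.2.continuousOn.isOpen_inter_preimage hA.1 hB.1, ⟨⟨hp.1, ?_⟩, ?_⟩, ?_, ?_⟩
    · exact mem_source y
    · have : (chart y ∘ f ∘ (chart x).symm) p = chart y y := rfl
      rw [Set.mem_preimage, this]
      exact chart_mem_chartImage y _ hp.2
    · rintro q ⟨hq, hq'⟩
      refine ⟨hq.1, ?_⟩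
      have h2 := hq'.2
      simp only [Function.comp_apply, Set.mem_preimage] at h2
      rw [(chart y).left_inv hq.2] at h2
      exact h2
    · refine (hB.2.comp (hA.2.mono Set.inter_subset_left) (fun q hq => hq.2)).congr ?_
      rintro q ⟨hq, hq'⟩
      simp only [Function.comp_apply]
      rw [(chart y).left_inv hq.2]
  constructor
  · rw [isOpen_iff_mem_nhds]
    intro p hp
    obtain ⟨V, hV, hpV, hs, -⟩ := key p hp
    exact Filter.mem_of_superset (hV.mem_nhds hpV) hs
  · intro p hp
    obtain ⟨V, hV, hpV, hs, hc⟩ := key p hp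
    exact ((hc p hpV).contDiffAt (hV.mem_nhds hpV)).contDiffWithinAt

lemma IsSmooth.differentiableAt {f : M → N} (hf : IsSmooth f) (x : M) :
    DifferentiableAt ℝ (chart (f x) ∘ f ∘ (chart x).symm) (chart x x) := by
  have h := hf x (f x)
  have hm : chart x x ∈ chartImage x (f ⁻¹' (chart (f x)).source) :=
    chart_mem_chartImage x _ (mem_source (f x))
  exact ((h.2 _ hm).contDiffAt (h.1.mem_nhds hm)).differentiableAt (by simp)

lemma tmap_id (x : M) : tmap (id : M → M) x = ContinuousLinearMap.id ℝ _ := by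
  have : (chart (id x) ∘ id ∘ (chart x).symm) =ᶠ[nhds (chart x x)] id := by
    filter_upwards [(isOpen_target x).mem_nhds ((chart x).map_source (mem_source x))] with p hp
    exact (chart x).right_inv hp
  exact this.fderiv_eq.trans fderiv_id

lemma tmap_comp {g : N → P} {f : M → N} (hg : IsSmooth g) (hf : IsSmooth f) (x : M) :
    tmap (g ∘ f) x = (tmap g (f x)).comp (tmap f x) := by
  have h1 : (chart ((g ∘ f) x) ∘ (g ∘ f) ∘ (chart x).symm) =ᶠ[nhds (chart x x)]
      (chart (g (f x)) ∘ g ∘ (chart (f x)).symm) ∘ (chart (f x) ∘ f ∘ (chart x).symm) := by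
    have hm : chart x x ∈ chartImage x (f ⁻¹' (chart (f x)).source) :=
      chart_mem_chartImage x _ (mem_source (f x))
    filter_upwards [(hf x (f x)).1.mem_nhds hm] with p hp
    simp only [Function.comp_apply]
    rw [(chart (f x)).left_inv hp.2]
  have hx : (chart (f x) ∘ f ∘ (chart x).symm) (chart x x) = chart (f x) (f x) := by
    simp only [Function.comp_apply]
    rw [(chart x).left_inv (mem_source x)]
  have h2 := hg.differentiableAt (f x)
  unfold tmap
  rw [h1.fderiv_eq, fderiv_comp]
  · rw [hx]
  · rw [hx]; exact h2
  · exact hf.differentiableAt x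

end BanachManifold

open BanachManifold

/-! ### Hermitian vector bundles -/

lemma ContDiffOn.complex_clm_apply {G E F : Type*} [NormedAddCommGroup G] [NormedSpace ℝ G]
    [NormedAddCommGroup E] [NormedSpace ℂ E] [NormedAddCommGroup F] [NormedSpace ℂ F]
    {A : G → E →L[ℂ] F} {v : G → E} {s : Set G}
    (hA : ContDiffOn ℝ ∞ A s) (hv : ContDiffOn ℝ ∞ v s) :
    ContDiffOn ℝ ∞ (fun g => A g (v g)) s :=
  ((ContinuousLinearMap.restrictScalarsL ℂ E F ℝ ℝ).contDiff.comp_contDiffOn hA).clm_apply hv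

/-- A Hermitian vector bundle `Π : D → Z` on a Banach manifold: complex Hilbert spaces `D_z`,
local trivializations over open sets `dom z ∋ z` with smooth transition maps (for the operator
norm), in which the scalar product is smooth.  The typical fiber of the trivialization around `z`
is taken to be `D_z`; `triv z w : D_w → D_z` is that trivialization on the fiber at `w ∈ dom z`
(no condition is imposed for `w ∉ dom z`).  The scalar product `inner ℂ x y` is linear
in the second variable. -/
structure Herm where
  Base : Type u
  [manifold : BanachManifold Base]
  Fiber : Base → Type u
  [normedAddCommGroup : ∀ z, NormedAddCommGroup (Fiber z)]
  [innerProductSpace : ∀ z, InnerProductSpace ℂ (Fiber z)]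
  [completeSpace : ∀ z, CompleteSpace (Fiber z)]
  dom : Base → Set Base
  mem_dom : ∀ z, z ∈ dom z
  isOpenSet_dom : ∀ z, IsOpenSet (dom z)
  triv : ∀ z w, Fiber w →L[ℂ] Fiber z
  triv_invertible : ∀ z w, w ∈ dom z → (triv z w).IsInvertible
  contDiffOn_transition : ∀ z z' x,
    ContDiffOn ℝ ∞
      (fun p : Model x => (triv z' ((chart x).symm p)).comp (triv z ((chart x).symm p)).inverse)
      (chartImage x (dom z ∩ dom z'))
  contDiffOn_inner : ∀ z x,
    ContDiffOn ℝ ∞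
      (fun q : Model x × Fiber z × Fiber z =>
        inner ℂ ((triv z ((chart x).symm q.1)).inverse q.2.1)
          ((triv z ((chart x).symm q.1)).inverse q.2.2))
      (chartImage x (dom z) ×ˢ Set.univ)

attribute [instance] Herm.manifold Herm.normedAddCommGroup Herm.innerProductSpace
  Herm.completeSpace

namespace Herm

/-- The total space `D` of the bundle. -/
def Total (D : Herm.{u}) : Type u := Σ z : D.Base, D.Fiber z

variable (D : Herm.{u})

/-- The bundle projection. -/
def proj (ξ : D.Total) : D.Base := ξ.1

/-- The chart of the total space given by the chart of the base and the trivialization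
around `z`. -/
def totalChart (z : D.Base) : PartialEquiv D.Total (Model z × D.Fiber z) where
  toFun ξ := (chart z ξ.1, D.triv z ξ.1 ξ.2)
  invFun q := ⟨(chart z).symm q.1, (D.triv z ((chart z).symm q.1)).inverse q.2⟩
  source := {ξ | ξ.1 ∈ (chart z).source ∩ D.dom z}
  target := chartImage z (D.dom z) ×ˢ Set.univ
  map_source' := by
    rintro ⟨w, x⟩ ⟨h1, h2⟩
    refine ⟨⟨(chart z).map_source h1, ?_⟩, trivial⟩
    simp only [Set.mem_preimage]
    rw [(chart z).left_inv h1]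
    exact h2
  map_target' := by
    rintro ⟨p, x⟩ ⟨⟨h1, h2⟩, -⟩
    exact ⟨(chart z).map_target h1, h2⟩
  left_inv' := by
    rintro ⟨w, x⟩ ⟨h1, h2⟩
    simp only
    rw [(chart z).left_inv h1, (D.triv_invertible z w h2).inverse_apply_self]
  right_inv' := by
    rintro ⟨p, x⟩ ⟨⟨h1, h2⟩, -⟩
    simp only
    rw [(chart z).right_inv h1, (D.triv_invertible z _ h2).self_apply_inverse]

lemma totalChart_overlap (z z' : D.Base) :
    (D.totalChart z).target ∩ (D.totalChart z).symm ⁻¹' (D.totalChart z').source =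
      (((chart z).target ∩ (chart z).symm ⁻¹' (chart z').source) ∩
        chartImage z (D.dom z) ∩ chartImage z (D.dom z')) ×ˢ Set.univ := by
  ext ⟨p, x⟩
  constructor
  · rintro ⟨⟨h1, -⟩, h2, h3⟩
    exact ⟨⟨⟨⟨h1.1, h2⟩, h1⟩, ⟨h1.1, h3⟩⟩, trivial⟩
  · rintro ⟨⟨⟨⟨h1, h2⟩, h3⟩, h4⟩, -⟩
    exact ⟨⟨h3, trivial⟩, h2, h4.2⟩

/-- The total space is a Banach manifold, modelled on `T_z Z × D_z` around the points of `D_z`. -/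
instance : BanachManifold D.Total where
  Model ξ := Model ξ.1 × D.Fiber ξ.1
  chart ξ := D.totalChart ξ.1
  mem_source ξ := ⟨mem_source ξ.1, D.mem_dom ξ.1⟩
  isOpen_overlap ξ η := by
    rw [totalChart_overlap]
    exact (((isOpen_overlap ξ.1 η.1).inter (D.isOpenSet_dom ξ.1 ξ.1)).inter
      (D.isOpenSet_dom η.1 ξ.1)).prod isOpen_univ
  contDiffOn_overlap ξ η := by
    rw [totalChart_overlap]
    have h1 := contDiffOn_overlap ξ.1 η.1
    have h2 := D.contDiffOn_transition ξ.1 η.1 ξ.1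
    have h3 : ContDiffOn ℝ ∞ (fun q : Model ξ.1 × D.Fiber ξ.1 =>
        ((D.triv η.1 ((chart ξ.1).symm q.1)).comp (D.triv ξ.1 ((chart ξ.1).symm q.1)).inverse) q.2)
        ((((chart ξ.1).target ∩ (chart ξ.1).symm ⁻¹' (chart η.1).source) ∩
        chartImage ξ.1 (D.dom ξ.1) ∩ chartImage ξ.1 (D.dom η.1)) ×ˢ Set.univ) :=
      (h2.comp contDiffOn_fst fun q hq => ⟨hq.1.2.1, hq.1.1.2.2, hq.1.2.2⟩).complex_clm_apply
        contDiffOn_snd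
    exact (h1.comp contDiffOn_fst fun q hq => hq.1.1.1).prodMk h3

/-- The map `δ` between the total spaces given by a map between the bases and operators between
the fibers. -/
def totalMap {D D' : Herm.{u}} (base : D.Base → D'.Base)
    (fib : ∀ z, D.Fiber z ≃L[ℂ] D'.Fiber (base z)) (ξ : D.Total) : D'.Total :=
  ⟨base ξ.1, fib ξ.1 ξ.2⟩

/-- Smoothness of a map between total spaces in terms of the trivializations. -/
lemma isSmooth_totalMap {D D' : Herm.{u}} (base : D.Base → D'.Base)
    (fib : ∀ z, D.Fiber z ≃L[ℂ] D'.Fiber (base z))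
    (h : ∀ z z', IsOpen (chartImage z (D.dom z ∩ base ⁻¹' ((chart z').source ∩ D'.dom z'))) ∧
      ContDiffOn ℝ ∞ (fun q : Model z × D.Fiber z =>
        (chart z' (base ((chart z).symm q.1)),
          D'.triv z' (base ((chart z).symm q.1))
            (fib ((chart z).symm q.1) ((D.triv z ((chart z).symm q.1)).inverse q.2))))
        (chartImage z (D.dom z ∩ base ⁻¹' ((chart z').source ∩ D'.dom z')) ×ˢ Set.univ)) :
    IsSmooth (totalMap base fib) := by
  intro ξ η
  have e : chartImage ξ (totalMap base fib ⁻¹' (chart η).source) =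
      chartImage ξ.1 (D.dom ξ.1 ∩ base ⁻¹' ((chart η.1).source ∩ D'.dom η.1)) ×ˢ
        (Set.univ : Set (D.Fiber ξ.1)) := by
    ext ⟨p, x⟩
    constructor
    · rintro ⟨⟨⟨h1, h2⟩, -⟩, h3⟩
      exact ⟨⟨h1, h2, h3⟩, trivial⟩
    · rintro ⟨⟨h1, h2, h3⟩, -⟩
      exact ⟨⟨⟨h1, h2⟩, trivial⟩, h3⟩
  have key := And.intro ((h ξ.1 η.1).1.prod (isOpen_univ (X := D.Fiber ξ.1))) (h ξ.1 η.1).2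
  rw [← e] at key
  exact key

/-- Morphisms `Θ = (δ, ζ)` of Hermitian bundles: a smooth map `ζ` between the bases and a smooth
map `δ` between the total spaces which maps the fiber over `z` onto the fiber over `ζ z` by an
invertible bounded complex linear operator. -/
structure Hom (D D' : Herm.{u}) where
  base : D.Base → D'.Base
  fib : ∀ z, D.Fiber z ≃L[ℂ] D'.Fiber (base z)
  isSmooth_base : IsSmooth base
  isSmooth_total : IsSmooth (totalMap base fib)

/-- The map `δ` between the total spaces. -/
def Hom.total {D D' : Herm.{u}} (Θ : Hom D D') (ξ : D.Total) : D'.Total :=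
  totalMap Θ.base Θ.fib ξ

lemma Hom.ext_total {D D' : Herm.{u}} {Θ Θ' : Hom D D'} (h : Θ.total = Θ'.total) : Θ = Θ' := by
  obtain ⟨b, f, h1, h2⟩ := Θ
  obtain ⟨b', f', h1', h2'⟩ := Θ'
  have hb : b = b' := by
    funext z
    exact congrArg Sigma.fst (congrFun h ⟨z, 0⟩)
  subst hb
  have hf : f = f' := by
    funext z
    ext x
    exact eq_of_heq (Sigma.mk.inj (congrFun h ⟨z, x⟩)).2
  subst hf
  rfl

/-- The category of Hermitian vector bundles. -/
instance : Category.{u} Herm.{u} where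
  Hom := Hom
  id D :=
    { base := id
      fib := fun z => ContinuousLinearEquiv.refl ℂ (D.Fiber z)
      isSmooth_base := isSmooth_id
      isSmooth_total := isSmooth_id }
  comp Θ Θ' :=
    { base := Θ'.base ∘ Θ.base
      fib := fun z => (Θ.fib z).trans (Θ'.fib (Θ.base z))
      isSmooth_base := Θ'.isSmooth_base.comp Θ.isSmooth_base
      isSmooth_total := Θ'.isSmooth_total.comp Θ.isSmooth_total }

lemma total_id (D : Herm.{u}) : Hom.total (𝟙 D) = id := rfl

lemma total_comp {D D' D'' : Herm.{u}} (Θ : D ⟶ D') (Θ' : D' ⟶ D'') :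
    Hom.total (Θ ≫ Θ') = Hom.total Θ' ∘ Hom.total Θ := rfl

lemma Hom.isSmooth {D D' : Herm.{u}} (Θ : Hom D D') : IsSmooth Θ.total := Θ.isSmooth_total

/-- The tangent vector to the total space at `ξ` with components `X` (in the base direction) and
`v` (in the fiber direction), in the chart around `ξ`. -/
def tvec {D : Herm.{u}} (ξ : D.Total) (X : TangentSp ξ.1) (v : D.Fiber ξ.1) : TangentSp ξ := (X, v)

/-- The fiber component of a tangent vector to the total space at `ξ`, in the chart
around `ξ`. -/
def tfib {D : Herm.{u}} {ξ : D.Total} (v : TangentSp ξ) : D.Fiber ξ.1 := v.2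

end Herm

/-! ### Linear connections -/

/-- A linear connection on the bundle `Π : D → Z`: a smooth map `Φ : TD → TD` which is an
endomorphism of the vector bundle `TD → D`, satisfies `Φ ∘ Φ = Φ`, has range `Ker (T_ξ Π)` at
every `ξ`, and is linear on the fibers of the vector bundle `TΠ : TD → TZ`.  In the charts around
the points of `D_z`, the fiber of `TΠ` over `X ∈ T_z Z` consists of the vectors
`tvec ⟨z, x⟩ X v` and its linear structure is the one of the pairs `(x, v)`; the values of `Φ` lie
in the fiber over `0 ∈ T_z Z`. -/
structure LinearConnection (D : Herm.{u}) where
  Φ : ∀ ξ : D.Total, TangentSp ξ →L[ℝ] TangentSp ξ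
  isSmooth : IsSmoothTangentEndo Φ
  idem : ∀ ξ, (Φ ξ).comp (Φ ξ) = Φ ξ
  range_eq_ker : ∀ ξ, Set.range (Φ ξ) = {v | tmap D.proj ξ v = 0}
  map_add : ∀ (z : D.Base) (X : TangentSp z) (x y v w : D.Fiber z),
    Herm.tfib (Φ ⟨z, x + y⟩ (Herm.tvec ⟨z, x + y⟩ X (v + w))) =
      Herm.tfib (Φ ⟨z, x⟩ (Herm.tvec ⟨z, x⟩ X v)) + Herm.tfib (Φ ⟨z, y⟩ (Herm.tvec ⟨z, y⟩ X w))
  map_smul : ∀ (z : D.Base) (X : TangentSp z) (c : ℂ) (x v : D.Fiber z),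
    Herm.tfib (Φ ⟨z, c • x⟩ (Herm.tvec ⟨z, c • x⟩ X (c • v))) =
      c • Herm.tfib (Φ ⟨z, x⟩ (Herm.tvec ⟨z, x⟩ X v))

/-- `Φ = Θ^*(Φ')`: the connection `Φ` is the pull-back of `Φ'` through `Θ = (δ, ζ)`, that is,
`Tδ ∘ Φ = Φ' ∘ Tδ`. -/
def IsPullbackConnection {D D' : Herm.{u}} (Θ : D ⟶ D') (Φ : LinearConnection D)
    (Φ' : LinearConnection D') : Prop :=
  ∀ ξ : D.Total,
    (tmap (Herm.Hom.total Θ) ξ).comp (Φ.Φ ξ) =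
      (Φ'.Φ (Herm.Hom.total Θ ξ)).comp (tmap (Herm.Hom.total Θ) ξ)

/-- Objects of the category of linear connections on Hermitian bundles. -/
structure LinConnect where
  bundle : Herm.{u}
  conn : LinearConnection bundle

namespace LinConnect

/-- Morphisms of linear connections: bundle morphisms which pull back the second connection to
the first one. -/
@[ext]
structure Hom (C C' : LinConnect.{u}) where
  hom : C.bundle ⟶ C'.bundle
  pullback : IsPullbackConnection hom C.conn C'.conn

instance : Category.{u} LinConnect.{u} where
  Hom := Hom
  id C := ⟨𝟙 C.bundle, fun ξ => by
    rw [Herm.total_id, tmap_id]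
    rfl⟩
  comp Θ Θ' := ⟨Θ.hom ≫ Θ'.hom, fun ξ => by
    rw [Herm.total_comp, tmap_comp (Herm.Hom.isSmooth Θ'.hom) (Herm.Hom.isSmooth Θ.hom),
      ContinuousLinearMap.comp_assoc, Θ.pullback ξ, ← ContinuousLinearMap.comp_assoc,
      Θ'.pullback, ContinuousLinearMap.comp_assoc]
    rfl⟩

/-- The forgetful functor from linear connections to Hermitian bundles. -/
def forget : LinConnect.{u} ⥤ Herm.{u} where
  obj C := C.bundle
  map Θ := Θ.hom

end LinConnect

/-! ### The Grassmann manifold and the tautological bundle -/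

/-- The category of complex Hilbert spaces. -/
structure Hilb where
  carrier : Type u
  [normedAddCommGroup : NormedAddCommGroup carrier]
  [innerProductSpace : InnerProductSpace ℂ carrier]
  [completeSpace : CompleteSpace carrier]

attribute [instance] Hilb.normedAddCommGroup Hilb.innerProductSpace Hilb.completeSpace

instance : CoeSort Hilb.{u} (Type u) := ⟨Hilb.carrier⟩

/-- The morphisms of complex Hilbert spaces are the linear isometries. -/
instance : Category.{u} Hilb.{u} where
  Hom H H' := H →ₗᵢ[ℂ] H'
  id _ := LinearIsometry.id
  comp V W := W.comp V

/-- The set of all closed linear subspaces of a Hilbert space. -/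
@[ext]
structure Gr (H : Hilb.{u}) : Type u where
  toSubmodule : Submodule ℂ H
  isClosed : IsClosed (toSubmodule : Set H)

namespace Gr

variable {H : Hilb.{u}}

instance (S : Gr H) : CompleteSpace S.1 := S.2.completeSpace_coe

/-- The orthogonal projection `p_S : H → S`. -/
def p (S : Gr H) : H →L[ℂ] S.1 := S.1.orthogonalProjectionOnto

/-- The orthogonal projection onto the orthogonal complement of `S`. -/
def q (S : Gr H) : H →L[ℂ] S.1ᗮ := S.1ᗮ.orthogonalProjectionOnto

/-- The subspace `{x + T x | x ∈ S}`, for a bounded operator `T : S → Sᗮ`. -/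
def graph (S : Gr H) (T : S.1 →L[ℂ] S.1ᗮ) : Gr H :=
  ⟨LinearMap.ker ((S.q - T.comp S.p : H →L[ℂ] S.1ᗮ) : H →ₗ[ℂ] S.1ᗮ),
    (S.q - T.comp S.p : H →L[ℂ] S.1ᗮ).isClosed_ker⟩

lemma mem_graph {S : Gr H} {T : S.1 →L[ℂ] S.1ᗮ} {h : H} :
    h ∈ (S.graph T).1 ↔ S.q h = T (S.p h) := by
  simp [graph, sub_eq_zero]

lemma add_eq (S : Gr H) (h : H) : (S.p h : H) + (S.q h : H) = h :=
  S.1.starProjection_add_starProjection_orthogonal h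

lemma p_coe (S : Gr H) (x : S.1) : S.p x = x :=
  S.1.orthogonalProjectionOnto_mem_subspace_eq_self x

lemma q_coe (S : Gr H) (x : S.1ᗮ) : S.q x = x :=
  S.1ᗮ.orthogonalProjectionOnto_mem_subspace_eq_self x

lemma p_coe_orthogonal (S : Gr H) (x : S.1ᗮ) : S.p x = 0 :=
  S.1.orthogonalProjectionOnto_eq_zero_iff.2 x.2

lemma q_coe_self (S : Gr H) (x : S.1) : S.q x = 0 :=
  S.1ᗮ.orthogonalProjectionOnto_eq_zero_iff.2 (S.1.le_orthogonal_orthogonal x.2)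

lemma eq_of (S : Gr H) {h h' : H} (hp : S.p h = S.p h') (hq : S.q h = S.q h') : h = h' := by
  rw [← S.add_eq h, ← S.add_eq h', hp, hq]

/-- The operator `x ↦ x + T x`. -/
def jmap (S : Gr H) (T : S.1 →L[ℂ] S.1ᗮ) : S.1 →L[ℂ] H :=
  S.1.subtypeL + S.1ᗮ.subtypeL.comp T

lemma p_jmap (S : Gr H) (T : S.1 →L[ℂ] S.1ᗮ) (x : S.1) : S.p (S.jmap T x) = x := by
  simp [jmap, p_coe, p_coe_orthogonal]

lemma q_jmap (S : Gr H) (T : S.1 →L[ℂ] S.1ᗮ) (x : S.1) : S.q (S.jmap T x) = T x := by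
  simp [jmap, q_coe, q_coe_self]

lemma p_comp_jmap (S : Gr H) (T : S.1 →L[ℂ] S.1ᗮ) :
    S.p.comp (S.jmap T) = ContinuousLinearMap.id ℂ S.1 := by
  ext x : 1
  exact S.p_jmap T x

/-- `J` is a bounded operator which is a bijection onto the closed subspace `W`. -/
def Param {E : Type u} [NormedAddCommGroup E] [NormedSpace ℂ E] (J : E →L[ℂ] H) (W : Gr H) :
    Prop :=
  Function.Injective J ∧ ∀ h, h ∈ W.1 ↔ ∃ x, J x = h

lemma param_jmap (S : Gr H) (T : S.1 →L[ℂ] S.1ᗮ) : Param (S.jmap T) (S.graph T) := by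
  constructor
  · intro x y hxy
    rw [← S.p_jmap T x, hxy, S.p_jmap]
  · intro h
    rw [mem_graph]
    constructor
    · intro hh
      refine ⟨S.p h, S.eq_of (S.p_jmap T _) ?_⟩
      rw [q_jmap, hh]
    · rintro ⟨x, rfl⟩
      rw [q_jmap, p_jmap]

lemma param_subtype (W : Gr H) : Param W.1.subtypeL W :=
  ⟨Subtype.val_injective, fun h => ⟨fun hh => ⟨⟨h, hh⟩, rfl⟩, by rintro ⟨x, rfl⟩; exact x.2⟩⟩

lemma graph_injective (S : Gr H) : Function.Injective S.graph := by
  intro T T' h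
  ext x : 1
  have h1 : S.jmap T x ∈ (S.graph T').1 := by
    rw [← h]
    exact ((param_jmap S T).2 _).2 ⟨x, rfl⟩
  rw [mem_graph, q_jmap, p_jmap] at h1
  exact h1

lemma Param.graph_eq {E : Type u} [NormedAddCommGroup E] [NormedSpace ℂ E] {J : E →L[ℂ] H}
    {W : Gr H} (hJ : Param J W) (S : Gr H) (h : (S.p.comp J).IsInvertible) :
    S.graph ((S.q.comp J).comp (S.p.comp J).inverse) = W := by
  apply Gr.ext
  ext x
  rw [mem_graph, hJ.2]
  constructor
  · intro hx
    refine ⟨(S.p.comp J).inverse (S.p x), S.eq_of ?_ ?_⟩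
    · exact h.self_apply_inverse (S.p x)
    · rw [hx]
      rfl
  · rintro ⟨y, rfl⟩
    have : (S.p.comp J).inverse (S.p (J y)) = y := h.inverse_apply_self y
    simp [this]

section
variable {E : Type u} [NormedAddCommGroup E] [NormedSpace ℂ E] [CompleteSpace E]
  {J : E →L[ℂ] H} {W : Gr H}

lemma Param.equiv (hJ : Param J W) : ∃ e : E ≃L[ℂ] W.1, ∀ x, (e x : H) = J x := by
  let J' : E →L[ℂ] W.1 := J.codRestrict W.1 fun x => (hJ.2 _).2 ⟨x, rfl⟩
  have hi : LinearMap.ker (J' : E →ₗ[ℂ] W.1) = ⊥ := by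
    rw [LinearMap.ker_eq_bot]
    intro x y hxy
    exact hJ.1 (congrArg Subtype.val hxy)
  have hs : LinearMap.range (J' : E →ₗ[ℂ] W.1) = ⊤ := by
    rw [LinearMap.range_eq_top]
    rintro ⟨h, hh⟩
    obtain ⟨x, hx⟩ := (hJ.2 h).1 hh
    exact ⟨x, Subtype.ext hx⟩
  exact ⟨ContinuousLinearEquiv.ofBijective J' hi hs, fun x => rfl⟩

lemma Param.mem_range_graph_iff (hJ : Param J W) (S : Gr H) :
    W ∈ Set.range S.graph ↔ (S.p.comp J).IsInvertible := by
  constructor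
  · rintro ⟨T, rfl⟩
    have hi : LinearMap.ker ((S.p.comp J : E →L[ℂ] S.1) : E →ₗ[ℂ] S.1) = ⊥ := by
      rw [LinearMap.ker_eq_bot']
      intro x hx
      have hx' : S.p (J x) = 0 := hx
      have h1 : S.q (J x) = T (S.p (J x)) := mem_graph.1 ((hJ.2 _).2 ⟨x, rfl⟩)
      apply hJ.1
      apply S.eq_of
      · simp [hx']
      · simp [h1, hx']
    have hs : LinearMap.range ((S.p.comp J : E →L[ℂ] S.1) : E →ₗ[ℂ] S.1) = ⊤ := by
      rw [LinearMap.range_eq_top]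
      intro y
      obtain ⟨x, hx⟩ := (hJ.2 _).1 (((param_jmap S T).2 _).2 ⟨y, rfl⟩)
      refine ⟨x, ?_⟩
      change S.p (J x) = y
      rw [hx, p_jmap]
    exact ⟨ContinuousLinearEquiv.ofBijective _ hi hs, rfl⟩
  · intro h
    exact ⟨_, hJ.graph_eq S h⟩

end

/-- The chart of the Grassmann manifold at `S`: the subspaces of the form `{x + T x | x ∈ S}` are
mapped to the bounded operators `T : S → Sᗮ`. -/
def grChart (S : Gr H) : PartialEquiv (Gr H) (S.1 →L[ℂ] S.1ᗮ) where
  toFun := Function.invFun S.graph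
  invFun := S.graph
  source := Set.range S.graph
  target := Set.univ
  map_source' _ _ := trivial
  map_target' T _ := ⟨T, rfl⟩
  left_inv' := by
    rintro _ ⟨T, rfl⟩
    rw [Function.leftInverse_invFun S.graph_injective]
  right_inv' T _ := Function.leftInverse_invFun S.graph_injective T

lemma Param.grChart_eq {E : Type u} [NormedAddCommGroup E] [NormedSpace ℂ E] [CompleteSpace E]
    {J : E →L[ℂ] H} {W : Gr H} (hJ : Param J W) (S : Gr H) (h : (S.p.comp J).IsInvertible) :
    grChart S W = (S.q.comp J).comp (S.p.comp J).inverse := by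
  have h1 := (grChart S).right_inv (x := (S.q.comp J).comp (S.p.comp J).inverse) trivial
  have h2 : (grChart S).symm ((S.q.comp J).comp (S.p.comp J).inverse) = W := hJ.graph_eq S h
  rwa [h2] at h1

lemma contDiff_jmap (S : Gr H) : ContDiff ℂ ∞ S.jmap :=
  contDiff_const.add (contDiff_const.clm_comp contDiff_id)

lemma isOpen_invertible {E F : Type u} [NormedAddCommGroup E] [NormedSpace ℂ E] [CompleteSpace E]
    [NormedAddCommGroup F] [NormedSpace ℂ F] : IsOpen {A : E →L[ℂ] F | A.IsInvertible} :=
  ContinuousLinearEquiv.isOpen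

/-- Smoothness of the inverse of a smooth family of invertible operators. -/
lemma contDiffOn_inverse {G E F : Type u} [NormedAddCommGroup G] [NormedSpace ℂ G]
    [NormedAddCommGroup E] [NormedSpace ℂ E] [CompleteSpace E]
    [NormedAddCommGroup F] [NormedSpace ℂ F] {A : G → E →L[ℂ] F} (hA : ContDiff ℂ ∞ A)
    {s : Set G} (hs : ∀ g ∈ s, (A g).IsInvertible) :
    ContDiffOn ℂ ∞ (fun g => (A g).inverse) s := fun g hg =>
  ((hs g hg).contDiffAt_map_inverse.comp g hA.contDiffAt).contDiffWithinAt

instance : BanachManifold (Gr H) where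
  Model S := S.1 →L[ℂ] S.1ᗮ
  chart := grChart
  mem_source S := ⟨0, by
    apply Gr.ext
    ext h
    rw [mem_graph]
    constructor
    · intro hh
      rw [← S.add_eq h, hh]
      simp
    · intro hh
      exact S.q_coe_self ⟨h, hh⟩⟩
  isOpen_overlap S S' := by
    have : (grChart S).target ∩ (grChart S).symm ⁻¹' (grChart S').source =
        (fun T => S'.p.comp (S.jmap T)) ⁻¹' {A | A.IsInvertible} := by
      ext T
      exact ⟨fun h => ((param_jmap S T).mem_range_graph_iff S').1 h.2,
        fun h => ⟨trivial, ((param_jmap S T).mem_range_graph_iff S').2 h⟩⟩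
    rw [this]
    exact isOpen_invertible.preimage (contDiff_const.clm_comp S.contDiff_jmap).continuous
  contDiffOn_overlap S S' := by
    have h0 : ∀ T ∈ (grChart S).target ∩ (grChart S).symm ⁻¹' (grChart S').source,
        (S'.p.comp (S.jmap T)).IsInvertible := fun T hT =>
      ((param_jmap S T).mem_range_graph_iff S').1 hT.2
    have h1 : ContDiffOn ℂ ∞ (fun T => (S'.q.comp (S.jmap T)).comp (S'.p.comp (S.jmap T)).inverse)
        ((grChart S).target ∩ (grChart S).symm ⁻¹' (grChart S').source) :=
      ((contDiff_const.clm_comp S.contDiff_jmap).contDiffOn).clm_comp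
        (contDiffOn_inverse (contDiff_const.clm_comp S.contDiff_jmap) h0)
    refine (h1.restrict_scalars ℝ).congr fun T hT => ?_
    exact (param_jmap S T).grChart_eq S' (h0 T hT)

end Gr

namespace Gr

variable {H : Hilb.{u}}

/-- The restriction to `W` of the orthogonal projection onto `S`. -/
def proj (S W : Gr H) : W.1 →L[ℂ] S.1 := S.p.comp W.1.subtypeL

lemma proj_isInvertible {S W : Gr H} (h : W ∈ Set.range S.graph) : (S.proj W).IsInvertible :=
  ((param_subtype W).mem_range_graph_iff S).1 h

section
variable {E : Type u} [NormedAddCommGroup E] [NormedSpace ℂ E] [CompleteSpace E]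
  {J : E →L[ℂ] H} {W : Gr H}

lemma Param.comp_inverse_proj (hJ : Param J W) (S : Gr H) (h : (S.p.comp J).IsInvertible) :
    W.1.subtypeL.comp (S.proj W).inverse = J.comp (S.p.comp J).inverse := by
  obtain ⟨e, he⟩ := hJ.equiv
  have hS : (S.proj W).IsInvertible := proj_isInvertible ((hJ.mem_range_graph_iff S).2 h)
  ext x : 1
  have h1 : (S.proj W).inverse x = e ((S.p.comp J).inverse x) := by
    rw [hS.inverse_apply_eq]
    change x = S.p (e ((S.p.comp J).inverse x) : H)
    rw [he]
    exact (h.self_apply_inverse x).symm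
  change (((S.proj W).inverse x : W.1) : H) = J ((S.p.comp J).inverse x)
  rw [h1, he]

end

lemma invertible_of_mem {S S' : Gr H} {T : S.1 →L[ℂ] S.1ᗮ} (h : S.graph T ∈ Set.range S'.graph) :
    (S'.p.comp (S.jmap T)).IsInvertible :=
  ((param_jmap S T).mem_range_graph_iff S').1 h

end Gr

/-- The universal (tautological) bundle `{(S, x) | x ∈ S} → Gr H`, with the scalar product
of `H`. -/
def taut (H : Hilb.{u}) : Herm.{u} where
  Base := Gr H
  Fiber S := S.1
  dom S := Set.range S.graph
  mem_dom S := mem_source S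
  isOpenSet_dom S S' := isOpen_overlap S' S
  triv S W := S.proj W
  triv_invertible _ _ h := Gr.proj_isInvertible h
  contDiffOn_transition S S' S₂ := by
    have h1 : ContDiffOn ℂ ∞
        (fun T => S'.p.comp ((S₂.jmap T).comp (S.p.comp (S₂.jmap T)).inverse))
        (chartImage S₂ (Set.range S.graph ∩ Set.range S'.graph)) :=
      contDiffOn_const.clm_comp (S₂.contDiff_jmap.contDiffOn.clm_comp
        (Gr.contDiffOn_inverse (contDiff_const.clm_comp S₂.contDiff_jmap)
          fun T hT => Gr.invertible_of_mem hT.2.1))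
    refine (h1.restrict_scalars ℝ).congr fun T hT => ?_
    rw [← (Gr.param_jmap S₂ T).comp_inverse_proj S (Gr.invertible_of_mem hT.2.1)]
    rfl
  contDiffOn_inner S S₂ := by
    have h1 : ContDiffOn ℂ ∞
        (fun T => (S₂.jmap T).comp (S.p.comp (S₂.jmap T)).inverse)
        (chartImage S₂ (Set.range S.graph)) :=
      S₂.contDiff_jmap.contDiffOn.clm_comp
        (Gr.contDiffOn_inverse (contDiff_const.clm_comp S₂.contDiff_jmap)
          fun T hT => Gr.invertible_of_mem hT.2)
    have h2 : ContDiffOn ℝ ∞ (fun T => (S₂.jmap T).comp (S.p.comp (S₂.jmap T)).inverse)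
        (chartImage S₂ (Set.range S.graph)) := h1.restrict_scalars ℝ
    have h3 : ContDiffOn ℝ ∞ (fun r : (S₂.1 →L[ℂ] S₂.1ᗮ) × S.1 × S.1 =>
        (S₂.jmap r.1).comp (S.p.comp (S₂.jmap r.1)).inverse)
        (chartImage S₂ (Set.range S.graph) ×ˢ Set.univ) :=
      h2.comp contDiffOn_fst fun r hr => hr.1
    have h4 := (h3.complex_clm_apply (contDiff_fst.comp contDiff_snd).contDiffOn).inner ℂ
      (h3.complex_clm_apply (contDiff_snd.comp contDiff_snd).contDiffOn)
    refine h4.congr fun r hr => ?_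
    have h5 := (Gr.param_jmap S₂ r.1).comp_inverse_proj S (Gr.invertible_of_mem hr.1.2)
    simp only [Function.comp_apply]
    rw [← h5]
    rfl

/-- The point `(S, x)` of the universal bundle, for `x ∈ S`. -/
def tautPoint {H : Hilb.{u}} (S : Gr H) (x : S.1) : (taut H).Total := ⟨S, x⟩

/-- The subspace `S` of the point `(S, x)` of the universal bundle. -/
def tautSpace {H : Hilb.{u}} (ξ : (taut H).Total) : Gr H := ξ.1

/-- The vector `x` of the point `(S, x)` of the universal bundle. -/
def tautVec {H : Hilb.{u}} (ξ : (taut H).Total) : H :=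
  Subtype.val (p := fun h : H => h ∈ (tautSpace ξ).1) ξ.2

lemma taut_ext {H : Hilb.{u}} {ξ η : (taut H).Total} (h1 : tautSpace ξ = tautSpace η)
    (h2 : tautVec ξ = tautVec η) : ξ = η := by
  obtain ⟨S, x⟩ := ξ
  obtain ⟨S', y⟩ := η
  obtain rfl : S = S' := h1
  obtain rfl : x = y := Subtype.ext h2
  rfl

namespace Gr

variable {H H' : Hilb.{u}}

/-- The image of a closed subspace under a linear isometry. -/
def map (V : H →ₗᵢ[ℂ] H') (S : Gr H) : Gr H' where
  toSubmodule := S.1.map V.toLinearMap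
  isClosed := V.isometry.isClosedEmbedding.isClosedMap _ S.2

/-- The restriction of a linear isometry to a closed subspace, as a unitary operator onto
its image. -/
def mapFib (V : H →ₗᵢ[ℂ] H') (S : Gr H) : S.1 ≃L[ℂ] (S.map V).1 :=
  LinearIsometryEquiv.toContinuousLinearEquiv
    ⟨Submodule.equivMapOfInjective V.toLinearMap V.injective S.1, fun x => V.norm_map x⟩

lemma coe_mapFib (V : H →ₗᵢ[ℂ] H') (S : Gr H) (x : S.1) : (S.mapFib V x : H') = V x := rfl

lemma param_map (V : H →ₗᵢ[ℂ] H') (S : Gr H) (T : S.1 →L[ℂ] S.1ᗮ) :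
    Param (V.toContinuousLinearMap.comp (S.jmap T)) ((S.graph T).map V) := by
  refine ⟨V.injective.comp (param_jmap S T).1, fun h => ⟨?_, ?_⟩⟩
  · rintro ⟨x, hx, rfl⟩
    obtain ⟨y, rfl⟩ := ((param_jmap S T).2 x).1 hx
    exact ⟨y, rfl⟩
  · rintro ⟨y, rfl⟩
    exact ⟨S.jmap T y, ((param_jmap S T).2 _).2 ⟨y, rfl⟩, rfl⟩

lemma mem_map_iff (V : H →ₗᵢ[ℂ] H') (S : Gr H) (S' : Gr H') (T : S.1 →L[ℂ] S.1ᗮ) :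
    (S.graph T).map V ∈ Set.range S'.graph ↔
      (S'.p.comp (V.toContinuousLinearMap.comp (S.jmap T))).IsInvertible :=
  (param_map V S T).mem_range_graph_iff S'

lemma contDiff_map (V : H →ₗᵢ[ℂ] H') (S : Gr H) :
    ContDiff ℂ ∞ fun T => V.toContinuousLinearMap.comp (S.jmap T) :=
  contDiff_const.clm_comp S.contDiff_jmap

lemma isOpen_map (V : H →ₗᵢ[ℂ] H') (S : Gr H) (S' : Gr H') :
    IsOpen {T : S.1 →L[ℂ] S.1ᗮ | (S.graph T).map V ∈ Set.range S'.graph} := by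
  simp only [mem_map_iff]
  exact isOpen_invertible.preimage (contDiff_const.clm_comp (contDiff_map V S)).continuous

lemma contDiffOn_grChart_map (V : H →ₗᵢ[ℂ] H') (S : Gr H) (S' : Gr H') :
    ContDiffOn ℝ ∞ (fun T : S.1 →L[ℂ] S.1ᗮ => grChart S' ((S.graph T).map V))
      {T | (S.graph T).map V ∈ Set.range S'.graph} := by
  have h1 : ContDiffOn ℂ ∞ (fun T => (S'.q.comp (V.toContinuousLinearMap.comp (S.jmap T))).comp
      (S'.p.comp (V.toContinuousLinearMap.comp (S.jmap T))).inverse)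
      {T | (S.graph T).map V ∈ Set.range S'.graph} :=
    (contDiff_const.clm_comp (contDiff_map V S)).contDiffOn.clm_comp
      (contDiffOn_inverse (contDiff_const.clm_comp (contDiff_map V S))
        fun T hT => (mem_map_iff V S S' T).1 hT)
  exact (h1.restrict_scalars ℝ).congr fun T hT =>
    (param_map V S T).grChart_eq S' ((mem_map_iff V S S' T).1 hT)

end Gr

lemma Gr.inverse_proj_graph {H : Hilb.{u}} (S : Gr H) (T : S.1 →L[ℂ] S.1ᗮ) (x : S.1) :
    (((S.proj (S.graph T)).inverse x : (S.graph T).1) : H) = S.jmap T x := by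
  have hi : (S.p.comp (S.jmap T)).IsInvertible := by
    rw [Gr.p_comp_jmap]
    exact ⟨ContinuousLinearEquiv.refl ℂ S.1, rfl⟩
  have h3 := congrArg (fun A : S.1 →L[ℂ] H => A x) ((Gr.param_jmap S T).comp_inverse_proj S hi)
  simp only [Gr.p_comp_jmap, ContinuousLinearMap.inverse_id] at h3
  exact h3

lemma Gr.contDiffOn_totalMap {H H' : Hilb.{u}} (V : H →ₗᵢ[ℂ] H') (S : Gr H) (S' : Gr H') :
    ContDiffOn ℝ ∞ (fun r : (S.1 →L[ℂ] S.1ᗮ) × S.1 =>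
      (Gr.grChart S' ((S.graph r.1).map V),
        S'.proj ((S.graph r.1).map V)
          (Gr.mapFib V (S.graph r.1) ((S.proj (S.graph r.1)).inverse r.2))))
      ({T | (S.graph T).map V ∈ Set.range S'.graph} ×ˢ Set.univ) := by
  have h1 : ContDiffOn ℝ ∞ (fun r : (S.1 →L[ℂ] S.1ᗮ) × S.1 =>
      Gr.grChart S' ((S.graph r.1).map V))
      ({T | (S.graph T).map V ∈ Set.range S'.graph} ×ˢ Set.univ) :=
    (Gr.contDiffOn_grChart_map V S S').comp contDiffOn_fst fun r hr => hr.1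
  have h2 : ContDiff ℂ ∞ fun r : (S.1 →L[ℂ] S.1ᗮ) × S.1 => S'.p (V (S.jmap r.1 r.2)) :=
    S'.p.contDiff.comp (V.toContinuousLinearMap.contDiff.comp
      ((S.contDiff_jmap.comp contDiff_fst).clm_apply contDiff_snd))
  have h3 : ∀ r : (S.1 →L[ℂ] S.1ᗮ) × S.1, S'.proj ((S.graph r.1).map V)
      (Gr.mapFib V (S.graph r.1) ((S.proj (S.graph r.1)).inverse r.2)) =
      S'.p (V (S.jmap r.1 r.2)) := fun r =>
    congrArg (fun h => S'.p (V h)) (Gr.inverse_proj_graph S r.1 r.2)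
  simp only [h3]
  exact h1.prodMk (h2.restrict_scalars ℝ).contDiffOn

lemma Gr.chartImage_map {H H' : Hilb.{u}} (V : H →ₗᵢ[ℂ] H') (S : Gr H) (S' : Gr H') :
    chartImage S (Set.range S.graph ∩ Gr.map V ⁻¹' (Set.range S'.graph ∩
      Set.range S'.graph)) = {T | (S.graph T).map V ∈ Set.range S'.graph} := by
  ext T
  exact ⟨fun h => h.2.2.1, fun h => ⟨trivial, ⟨T, rfl⟩, h, h⟩⟩

lemma isSmooth_tautMap {H H' : Hilb.{u}} (V : H →ₗᵢ[ℂ] H') :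
    IsSmooth (Herm.totalMap (D := taut H) (D' := taut H') (Gr.map V) (Gr.mapFib V)) := by
  refine Herm.isSmooth_totalMap _ _ fun (S : Gr H) (S' : Gr H') => ?_
  have h := And.intro (Gr.isOpen_map V S S') (Gr.contDiffOn_totalMap V S S')
  rw [← Gr.chartImage_map] at h
  exact h

/-- The morphism of universal bundles `(S, x) ↦ (V S, V x)` given by a linear isometry `V`. -/
def tautMap {H H' : Hilb.{u}} (V : H →ₗᵢ[ℂ] H') : taut H ⟶ taut H' where
  base := Gr.map V
  fib := Gr.mapFib V
  isSmooth_base := fun (S : Gr H) (S' : Gr H') => by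
    have e : chartImage S (Gr.map V ⁻¹' (chart S').source) =
        {T | (S.graph T).map V ∈ Set.range S'.graph} := Set.univ_inter _
    have key := And.intro (Gr.isOpen_map V S S') (Gr.contDiffOn_grChart_map V S S')
    rw [← e] at key
    exact key
  isSmooth_total := isSmooth_tautMap V

/-- The functor which maps a Hilbert space to its universal bundle. -/
def tautFunctor : Hilb.{u} ⥤ Herm.{u} where
  obj := taut
  map V := tautMap V
  map_id H := Herm.Hom.ext_total <| by
    funext ξ
    refine taut_ext ?_ rfl
    apply Gr.ext
    exact Submodule.map_id _
  map_comp V W := Herm.Hom.ext_total <| by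
    funext ξ
    refine taut_ext ?_ rfl
    apply Gr.ext
    exact (Submodule.map_comp V.toLinearMap W.toLinearMap _)

/-! ### The universal connection -/

section UniversalConnection

variable {H : Hilb.{u}}

lemma exp_mem_unitary (X : skewAdjoint (H →L[ℂ] H)) (t : ℝ) :
    NormedSpace.exp (t • (X : H →L[ℂ] H)) ∈ unitary (H →L[ℂ] H) := by
  let _ : NormedAlgebra ℚ (H →L[ℂ] H) := NormedAlgebra.restrictScalars ℚ ℂ (H →L[ℂ] H)
  exact NormedSpace.exp_mem_unitary_of_mem_skewAdjoint (skewAdjoint.smul_mem t X.2)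

/-- The unitary operator `u exp (t X)`, for `u` unitary and `X` in the Lie algebra of
skew-adjoint operators, as a linear isometry. -/
def unitaryCurve (u : unitary (H →L[ℂ] H)) (X : skewAdjoint (H →L[ℂ] H)) (t : ℝ) : H →ₗᵢ[ℂ] H :=
  (Unitary.linearIsometryEquiv
    (u * ⟨NormedSpace.exp (t • (X : H →L[ℂ] H)), exp_mem_unitary X t⟩)).toLinearIsometry

/-- The point `(u S₀, u x)` of the universal bundle, that is, the image of the class `[(u, x)]`
under the identification of `U(H) ×_{U(p)} S₀` with the universal bundle over the orbit
of `S₀`. -/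
def homPoint (u : unitary (H →L[ℂ] H)) (S₀ : Gr H) (x : S₀.1) : (taut H).Total :=
  Herm.Hom.total (tautMap (Unitary.linearIsometryEquiv u).toLinearIsometry) (tautPoint S₀ x)

/-- The curve `t ↦ (u exp (t X) S₀, u exp (t X) (x + t y))`, that is, `t ↦ [(u exp (t X), x + t y)]`
in the universal bundle. -/
def homCurve (u : unitary (H →L[ℂ] H)) (S₀ : Gr H) (X : skewAdjoint (H →L[ℂ] H)) (x y : S₀.1)
    (t : ℝ) : (taut H).Total :=
  Herm.Hom.total (tautMap (unitaryCurve u X t)) (tautPoint S₀ (x + (t : ℂ) • y))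

/-- The tangent vector `[((u, X), (x, y))]` to the universal bundle at `[(u, x)]`. -/
def homTangent (u : unitary (H →L[ℂ] H)) (S₀ : Gr H) (X : skewAdjoint (H →L[ℂ] H)) (x y : S₀.1) :
    TangentSp (homPoint u S₀ x) :=
  velocity (homPoint u S₀ x) (homCurve u S₀ X x y)

/-- The conditional expectation `E_p X = p X p + (1 - p) X (1 - p)` on the skew-adjoint operators,
for the orthogonal projection `p` onto `S₀`. -/
def condExp (S₀ : Gr H) (X : skewAdjoint (H →L[ℂ] H)) : skewAdjoint (H →L[ℂ] H) :=
  ⟨S₀.1.starProjection * X * S₀.1.starProjection +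
      (1 - S₀.1.starProjection) * X * (1 - S₀.1.starProjection), by
    have hp : star S₀.1.starProjection = S₀.1.starProjection :=
      (isSelfAdjoint_starProjection S₀.1).star_eq
    have hX : star (X : H →L[ℂ] H) = -X := skewAdjoint.mem_iff.1 X.2
    rw [skewAdjoint.mem_iff]
    simp only [star_add, star_mul, star_sub, star_one, hp, hX]
    noncomm_ring⟩

/-- The universal linear connection on the universal bundle: the map
`[((u, X), (x, y))] ↦ [((u, E_p X), (x, y))]`. -/
def LinearConnection.IsUniversal (Φ : LinearConnection (taut H)) : Prop :=
  ∀ (u : unitary (H →L[ℂ] H)) (S₀ : Gr H) (X : skewAdjoint (H →L[ℂ] H)) (x y : S₀.1),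
    Φ.Φ (homPoint u S₀ x) (homTangent u S₀ X x y) = homTangent u S₀ (condExp S₀ X) x y

end UniversalConnection

/-! ### Reproducing kernels -/

/-- A family of bounded operators `K(s, t) : D_t → D_s` on a Hermitian bundle which is positive
definite.  (The continuity of a reproducing kernel is part of the smoothness required of
admissible kernels.) -/
structure PosDefKernel (D : Herm.{u}) where
  ker : ∀ s t : D.Base, D.Fiber t →L[ℂ] D.Fiber s
  pos : ∀ (n : ℕ) (t : Fin n → D.Base) (η : ∀ j, D.Fiber (t j)),
    0 ≤ ∑ j, ∑ l, inner ℂ (η l) (ker (t l) (t j) (η j))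

/-- `K = Θ^*(K')`: the kernel `K` is the pull-back `K(s, t) = δ_s^* K'(ζ s, ζ t) δ_t` of `K'`
through `Θ = (δ, ζ)`. -/
def IsPullbackKernel {D D' : Herm.{u}} (Θ : Herm.Hom D D') (K : PosDefKernel D)
    (K' : PosDefKernel D') : Prop :=
  ∀ s t : D.Base,
    K.ker s t = (ContinuousLinearMap.adjoint (Θ.fib s : D.Fiber s →L[ℂ] D'.Fiber (Θ.base s))).comp
      ((K'.ker (Θ.base s) (Θ.base t)).comp (Θ.fib t : D.Fiber t →L[ℂ] D'.Fiber (Θ.base t)))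

namespace PosDefKernel

variable {D : Herm.{u}} (K : PosDefKernel D)

/-- The kernel is a smooth section of the bundle `Hom(p₂^* Π, p₁^* Π) → Z × Z`, expressed in the
local trivializations. -/
def IsSmoothKernel : Prop :=
  ∀ z z' x y : D.Base,
    ContDiffOn ℝ ∞
      (fun r : Model x × Model y =>
        (D.triv z ((chart x).symm r.1)).comp
          ((K.ker ((chart x).symm r.1) ((chart y).symm r.2)).comp
            (D.triv z' ((chart y).symm r.2)).inverse))
      (chartImage x (D.dom z) ×ˢ chartImage y (D.dom z'))

/-- The values `(K_ξ | K_η)`, in the convention in which `inner ℂ` is linear in the second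
variable. -/
def form (η ξ : D.Total) : ℂ := inner ℂ η.2 (K.ker η.1 ξ.1 ξ.2)

/-- Formal linear combinations of the sections `K_ξ`, `ξ ∈ D`. -/
def Pre (_K : PosDefKernel D) : Type u := D.Total →₀ ℂ

instance : AddCommGroup K.Pre := inferInstanceAs (AddCommGroup (D.Total →₀ ℂ))
instance : Module ℂ K.Pre := inferInstanceAs (Module ℂ (D.Total →₀ ℂ))

/-- The scalar product of formal linear combinations of the sections `K_ξ`. -/
def sesq (f g : D.Total →₀ ℂ) : ℂ :=
  f.sum fun η a => g.sum fun ξ b => star a * b * K.form η ξ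

lemma sesq_eq (f g : D.Total →₀ ℂ) :
    K.sesq f g = ∑ η ∈ f.support, ∑ ξ ∈ g.support, star (f η) * g ξ * K.form η ξ := rfl

lemma sesq_single (η ξ : D.Total) (a b : ℂ) :
    K.sesq (Finsupp.single η a) (Finsupp.single ξ b) = star a * b * K.form η ξ := by
  simp [sesq]

lemma sesq_add_left (f g h : D.Total →₀ ℂ) : K.sesq (f + g) h = K.sesq f h + K.sesq g h := by
  classical
  refine Finsupp.sum_add_index' (fun _ => by simp [Finsupp.sum]) (fun η a b => ?_)
  simp [add_mul, Finsupp.sum, Finset.sum_add_distrib]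

lemma sesq_add_right (f g h : D.Total →₀ ℂ) : K.sesq f (g + h) = K.sesq f g + K.sesq f h := by
  classical
  unfold sesq
  rw [← Finsupp.sum_add]
  refine Finsupp.sum_congr fun η _ => ?_
  refine Finsupp.sum_add_index' (fun _ => by simp) (fun η a b => ?_)
  ring

lemma sesq_smul_left (f g : D.Total →₀ ℂ) (c : ℂ) : K.sesq (c • f) g = star c * K.sesq f g := by
  refine (Finsupp.sum_smul_index (fun _ => by simp [Finsupp.sum])).trans ?_
  simp only [sesq, Finsupp.sum, Finset.mul_sum]
  refine Finset.sum_congr rfl fun η _ => Finset.sum_congr rfl fun ξ _ => ?_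
  simp only [star_mul']
  ring

lemma sesq_nonneg (f : D.Total →₀ ℂ) : 0 ≤ K.sesq f f := by
  have h := K.pos f.support.card (fun j => (f.support.equivFin.symm j).1.1)
    (fun j => f (f.support.equivFin.symm j).1 • (f.support.equivFin.symm j).1.2)
  have e : K.sesq f f = ∑ l : Fin f.support.card, ∑ j : Fin f.support.card,
      star (f (f.support.equivFin.symm l).1) * f (f.support.equivFin.symm j).1 *
        K.form (f.support.equivFin.symm l).1 (f.support.equivFin.symm j).1 := by
    rw [sesq_eq, ← Finset.sum_coe_sort f.support]
    refine Fintype.sum_equiv f.support.equivFin _ _ fun l => ?_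
    rw [← Finset.sum_coe_sort f.support]
    refine Fintype.sum_equiv f.support.equivFin _ _ fun j => ?_
    simp only [Equiv.symm_apply_apply]
  rw [e, Finset.sum_comm]
  refine h.trans_eq (Finset.sum_congr rfl fun j _ => Finset.sum_congr rfl fun l _ => ?_)
  rw [map_smul, inner_smul_left, inner_smul_right, form, starRingEnd_apply]
  ring

lemma form_symm (η ξ : D.Total) : star (K.form ξ η) = K.form η ξ := by
  have im0 : ∀ f : D.Total →₀ ℂ, (K.sesq f f).im = 0 := fun f =>
    (Complex.le_def.1 (K.sesq_nonneg f)).2.symm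
  have hs : ∀ ξ : D.Total, ∀ a : ℂ, (star a * a * K.form ξ ξ).im = 0 := fun ξ a => by
    have := im0 (Finsupp.single ξ a)
    rwa [sesq_single] at this
  have hc : ∀ c : ℂ, (c * K.form ξ η + star c * K.form η ξ).im = 0 := fun c => by
    have h := im0 (Finsupp.single ξ 1 + Finsupp.single η c)
    simp only [sesq_add_left, sesq_add_right, sesq_single] at h
    have h1 := hs ξ 1
    have h3 := hs η c
    simp only [Complex.add_im, star_one, one_mul, mul_one] at h h1 h3 ⊢
    linarith
  have h1 := hc 1
  have h2 := hc Complex.I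
  apply Complex.ext
  · simp at h2 ⊢
    linarith
  · simp at h1 ⊢
    linarith

lemma star_sesq (f g : D.Total →₀ ℂ) : star (K.sesq g f) = K.sesq f g := by
  rw [sesq_eq, sesq_eq, Finset.sum_comm, star_sum]
  refine Finset.sum_congr rfl fun η _ => ?_
  rw [star_sum]
  refine Finset.sum_congr rfl fun ξ _ => ?_
  rw [star_mul', star_mul', star_star, form_symm]
  ring

instance core : PreInnerProductSpace.Core ℂ K.Pre where
  inner f g := K.sesq f g
  conj_inner_symm f g := K.star_sesq f g
  re_inner_nonneg f := (Complex.le_def.1 (K.sesq_nonneg f)).1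
  add_left f g h := K.sesq_add_left f g h
  smul_left f g c := K.sesq_smul_left f g c

instance : SeminormedAddCommGroup K.Pre :=
  InnerProductSpace.Core.toSeminormedAddCommGroup (𝕜 := ℂ)

instance : InnerProductSpace ℂ K.Pre := InnerProductSpace.ofCore _

/-- The reproducing kernel Hilbert space `ℋ^K`: the completion of the span of the sections `K_ξ`,
`ξ ∈ D`, with the scalar product `(K_ξ | K_η) = (K(Π η, Π ξ) ξ | η)`. -/
def rkhs : Hilb.{u} := ⟨UniformSpace.Completion K.Pre⟩

/-- The map `ξ ↦ K_ξ`, `D → ℋ^K`. -/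
def hat (ξ : D.Total) : K.rkhs :=
  ((show K.Pre from Finsupp.single ξ (1 : ℂ) : K.Pre) : UniformSpace.Completion K.Pre)

/-- The defining property of the scalar product of `ℋ^K`. -/
lemma inner_hat (η ξ : D.Total) :
    inner ℂ (K.hat η) (K.hat ξ) = inner ℂ η.2 (K.ker η.1 ξ.1 ξ.2) := by
  refine (UniformSpace.Completion.inner_coe _ _).trans ?_
  refine (K.sesq_single η ξ 1 1).trans ?_
  simp [form]

/-- The map `ζ_K : Z → Gr(ℋ^K)`, `s ↦` the closure of `{K_ξ | ξ ∈ D_s}` (which is a linear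
subspace, because `ξ ↦ K_ξ` is linear on `D_s`). -/
def zeta (s : D.Base) : Gr K.rkhs where
  toSubmodule := (Submodule.span ℂ (Set.range fun x : D.Fiber s => K.hat ⟨s, x⟩)).topologicalClosure
  isClosed := Submodule.isClosed_topologicalClosure _

/-- Admissible kernels. -/
structure IsAdmissible : Prop where
  isSmoothKernel : K.IsSmoothKernel
  isInvertible : ∀ s, (K.ker s s).IsInvertible
  isSmooth_zeta : IsSmooth K.zeta

/-- `Δ` is the classifying morphism `Δ_K = (δ_K, ζ_K)` of the kernel `K`, with
`δ_K ξ = (ζ_K (Π ξ), K_ξ)`. -/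
def IsClassifying (Δ : D ⟶ taut K.rkhs) : Prop :=
  ∀ ξ : D.Total, tautSpace (Herm.Hom.total Δ ξ) = K.zeta (D.proj ξ) ∧
    tautVec (Herm.Hom.total Δ ξ) = K.hat ξ

end PosDefKernel

/-- The universal reproducing kernel `Q_H(S₁, S₂) = p_{S₁}|_{S₂}` on the universal bundle. -/
def univKernel (H : Hilb.{u}) : PosDefKernel (taut H) where
  ker (S₁ S₂ : Gr H) := S₁.proj S₂
  pos n t η := by
    let t' : Fin n → Gr H := t
    let η' : ∀ j, (t' j).1 := η
    have h : ∀ j l, inner ℂ (η' l) ((t' l).proj (t' j) (η' j)) = inner ℂ (η' l : H) (η' j : H) :=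
      fun j l => Submodule.inner_orthogonalProjectionOnto_eq_of_mem_left (η' l) (η' j : H)
    change 0 ≤ ∑ j, ∑ l, inner ℂ (η' l) ((t' l).proj (t' j) (η' j))
    simp only [h]
    rw [Finset.sum_comm]
    have : ∑ l, ∑ j, inner ℂ (η' l : H) (η' j : H) =
        inner ℂ (∑ l, (η' l : H)) (∑ j, (η' j : H)) := by
      rw [sum_inner]
      simp only [inner_sum]
    rw [this, inner_self_eq_norm_sq_to_K, ← RCLike.ofReal_pow]
    exact RCLike.ofReal_nonneg.2 (sq_nonneg _)

/-- Objects of the category of admissible kernels on Hermitian bundles. -/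
structure Kernh where
  bundle : Herm.{u}
  kernel : PosDefKernel bundle
  admissible : kernel.IsAdmissible

lemma inner_adjoint_comp {E F E' F' : Type u} [NormedAddCommGroup E] [InnerProductSpace ℂ E]
    [CompleteSpace E] [NormedAddCommGroup F] [InnerProductSpace ℂ F] [CompleteSpace F]
    [NormedAddCommGroup E'] [InnerProductSpace ℂ E'] [NormedAddCommGroup F']
    [InnerProductSpace ℂ F'] (A : E →L[ℂ] F) (B : F' →L[ℂ] F) (C : E' →L[ℂ] F') (y : E) (x : E') :
    inner ℂ y ((ContinuousLinearMap.adjoint A).comp (B.comp C) x) = inner ℂ (A y) (B (C x)) :=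
  ContinuousLinearMap.adjoint_inner_right A y (B (C x))

lemma isPullbackKernel_iff {D D' : Herm.{u}} (Θ : Herm.Hom D D') (K : PosDefKernel D)
    (K' : PosDefKernel D') : IsPullbackKernel Θ K K' ↔ ∀ (s t : D.Base) (y : D.Fiber s)
      (x : D.Fiber t), inner ℂ y (K.ker s t x) =
        inner ℂ (Θ.fib s y) (K'.ker (Θ.base s) (Θ.base t) (Θ.fib t x)) := by
  have key : ∀ (s t : D.Base) (y : D.Fiber s) (x : D.Fiber t),
      inner ℂ y ((ContinuousLinearMap.adjoint
        (Θ.fib s : D.Fiber s →L[ℂ] D'.Fiber (Θ.base s))).comp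
        ((K'.ker (Θ.base s) (Θ.base t)).comp
          (Θ.fib t : D.Fiber t →L[ℂ] D'.Fiber (Θ.base t))) x) =
        inner ℂ (Θ.fib s y) (K'.ker (Θ.base s) (Θ.base t) (Θ.fib t x)) := fun s t y x =>
    inner_adjoint_comp _ _ _ y x
  constructor
  · intro h s t y x
    exact (congrArg (fun A : D.Fiber t →L[ℂ] D.Fiber s => inner ℂ y (A x)) (h s t)).trans
      (key s t y x)
  · intro h s t
    ext x : 1
    exact ext_inner_left ℂ fun y => (h s t y x).trans (key s t y x).symm

namespace Kernh

/-- Morphisms of admissible kernels: bundle morphisms which pull back the second kernel to the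
first one. -/
@[ext]
structure Hom (K K' : Kernh.{u}) where
  hom : K.bundle ⟶ K'.bundle
  pullback : IsPullbackKernel hom K.kernel K'.kernel

instance : Category.{u} Kernh.{u} where
  Hom := Hom
  id K := ⟨𝟙 K.bundle, (isPullbackKernel_iff _ _ _).2 fun _ _ _ _ => rfl⟩
  comp Θ Θ' := ⟨Θ.hom ≫ Θ'.hom, (isPullbackKernel_iff _ _ _).2 fun s t y x =>
    ((isPullbackKernel_iff _ _ _).1 Θ.pullback s t y x).trans
      ((isPullbackKernel_iff _ _ _).1 Θ'.pullback _ _ _ _)⟩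

/-- The forgetful functor from admissible kernels to Hermitian bundles. -/
def forget : Kernh.{u} ⥤ Herm.{u} where
  obj K := K.bundle
  map Θ := Θ.hom

end Kernh

end

/-!
A bundle morphism `Θ = (δ, ζ)` reads `(p, x) ↦ (ζ p, A(p) x)` in local trivializations, with a
family `A` of invertible operators that is smooth for the operator norm
(`Herm.Hom.contDiffOn_localFibReal`).  A linear connection `Φ'` takes its values in the vertical
vectors, on which `Tδ` is `A`, so that `Tδ ∘ Φ = Φ' ∘ Tδ` has exactly one solution, namely
`Φ v = (0, A⁻¹ (Φ' (Tδ v))₂)`: pull-backs of linear connections exist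
(`LinearConnection.pullback`) and are unique (`LinearConnection.isPullbackConnection_unique`).
The theorem follows from this and from the following facts.

* The universal connection is `(X, v) ↦ (0, v)` at the points of the fiber over `S`, in the chart
  at `S`.  At the other points `(T, x)` of this chart it is
  `(X, v) ↦ (0, p_S p_W (X x + v + T v))`, where `W` is the graph of `T`
  (`tchart_vertProj`), and this is smooth because `p_W = J (J† J)⁻¹ J†` for the operator
  `J x = x + T x`.  It is universal because the operators `exp (t E_p X)` leave `S₀` invariant, and
  it is natural with respect to linear isometries `V` because `p_{V S} V (x + T x) = V x`
  (`isPullbackConnection_tautMap`).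
* For an admissible kernel, `ξ ↦ K_ξ` is bounded below on `D_s`, because the composition of its
  adjoint with it is the invertible operator `K(s, s)`.  Hence `δ_K` maps `D_s` onto `ζ_K s` by an
  invertible operator `e_s`, and `Δ_K` is smooth because the projection of `K_ξ` to `ζ_K z` is
  `(e_z†)⁻¹ K(z, Π ξ) ξ` (`PosDefKernel.isSmooth_classifying`).
* If `K = Θ^* K'`, the universal property of `ℋ^K` gives a linear isometry `V : ℋ^K → ℋ^K'` with
  `V K_ξ = K'_{δ ξ}`, so that `V_* ∘ Δ_K = Δ_{K'} ∘ Θ`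
  (`PosDefKernel.exists_classifying_comp_tautMap`).  By naturality, `Φ_K` and `Θ^* Φ_{K'}` are then
  pull-backs of one universal connection through one morphism, hence equal.
* For the universal kernel, `ℋ^Q` is identified with `H` by an isometry, so that `Δ_Q` is induced
  by an isometry and `Φ_Q` is the universal connection (`Kernh.connection_univKernel`).
* `Δ_K` is a morphism of kernels from `K` to `Q_{ℋ^K}`.  The value at `Δ_K` of a functor with the
  two properties thus exhibits its value at `K` as a pull-back of the universal connection through
  `Δ_K`, and such a pull-back is unique (`Kernh.eq_connectionFunctor`).
-/

noncomputable section

open BanachManifold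

/-! ### Local representatives of maps between Banach manifolds -/

namespace BanachManifold

variable {M N P : Type u} [BanachManifold M] [BanachManifold N] [BanachManifold P]

/-- The local representative of `f` in the chart at `a` of the domain and the chart at `b` of the
target. -/
def localRep (f : M → N) (a : M) (b : N) : Model a → Model b := chart b ∘ f ∘ (chart a).symm

lemma localRep_apply (f : M → N) (a : M) (b : N) {y : M} (hy : y ∈ (chart a).source) :
    localRep f a b (chart a y) = chart b (f y) :=
  congrArg (fun w => chart b (f w)) ((chart a).left_inv hy)

lemma mem_chartImage {a y : M} {s : Set M} (hy : y ∈ (chart a).source) (hs : y ∈ s) :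
    chart a y ∈ chartImage a s := by
  refine ⟨(chart a).map_source hy, ?_⟩
  rw [Set.mem_preimage, (chart a).left_inv hy]
  exact hs

lemma IsSmooth.contDiffAt_localRep {f : M → N} (hf : IsSmooth f) {a y : M} {b : N}
    (hy : y ∈ (chart a).source) (hb : f y ∈ (chart b).source) :
    ContDiffAt ℝ ∞ (localRep f a b) (chart a y) :=
  ((hf a b).2 _ (mem_chartImage hy hb)).contDiffAt
    ((hf a b).1.mem_nhds (mem_chartImage hy hb))

lemma IsSmooth.localRep_comp_eventuallyEq {f : M → N} (hf : IsSmooth f) (g : N → P)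
    {a y : M} {b : N} (c : P) (hy : y ∈ (chart a).source) (hb : f y ∈ (chart b).source) :
    localRep (g ∘ f) a c =ᶠ[nhds (chart a y)] localRep g b c ∘ localRep f a b := by
  filter_upwards [(hf a b).1.mem_nhds (mem_chartImage hy hb)] with p hp
  exact (localRep_apply g b c hp.2).symm

lemma IsSmooth.fderiv_localRep_comp {f : M → N} {g : N → P} (hg : IsSmooth g) (hf : IsSmooth f)
    {a y : M} {b : N} {c : P} (hy : y ∈ (chart a).source) (hb : f y ∈ (chart b).source)
    (hc : g (f y) ∈ (chart c).source) :
    fderiv ℝ (localRep (g ∘ f) a c) (chart a y) =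
      (fderiv ℝ (localRep g b c) (chart b (f y))).comp (fderiv ℝ (localRep f a b) (chart a y)) := by
  have h1 := localRep_apply f a b hy
  rw [(hf.localRep_comp_eventuallyEq g c hy hb).fderiv_eq, fderiv_comp, h1]
  · rw [h1]
    exact (hg.contDiffAt_localRep hb hc).differentiableAt (by simp)
  · exact (hf.contDiffAt_localRep hy hb).differentiableAt (by simp)

lemma fderiv_localRep_id_self {a y : M} (hy : y ∈ (chart a).source) :
    fderiv ℝ (localRep id a a) (chart a y) = ContinuousLinearMap.id ℝ _ := by
  have : localRep id a a =ᶠ[nhds (chart a y)] id := by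
    filter_upwards [(isOpen_target a).mem_nhds ((chart a).map_source hy)] with p hp
    exact (chart a).right_inv hp
  exact this.fderiv_eq.trans fderiv_id

lemma tchart_tchartSymm {a y : M} (hy : y ∈ (chart a).source) (v : Model a) :
    tchart a y (tchartSymm a y v) = v := by
  have h := isSmooth_id.fderiv_localRep_comp isSmooth_id (a := a) (b := y) (c := a) hy
    (mem_source y) hy
  have h2 := DFunLike.congr_fun (h.symm.trans (fderiv_localRep_id_self hy)) v
  exact h2

lemma tchartSymm_tchart {a y : M} (hy : y ∈ (chart a).source) (v : TangentSp y) :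
    tchartSymm a y (tchart a y v) = v := by
  have h := isSmooth_id.fderiv_localRep_comp isSmooth_id (a := y) (b := a) (c := y) (mem_source y)
    hy (mem_source y)
  have h2 := DFunLike.congr_fun (h.symm.trans (fderiv_localRep_id_self (mem_source y))) v
  exact h2

lemma hasFDerivAt_tchartSymm {a y : M} (hy : y ∈ (chart a).source) :
    HasFDerivAt (localRep id a y) (tchartSymm a y) (chart a y) :=
  ((isSmooth_id.contDiffAt_localRep hy (mem_source y)).differentiableAt (by simp)).hasFDerivAt

/-- The tangent map of `f` in arbitrary charts is the derivative of the local representative. -/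
lemma IsSmooth.fderiv_localRep_tchart {f : M → N} (hf : IsSmooth f) {a y : M} {b : N}
    (hy : y ∈ (chart a).source) (hb : f y ∈ (chart b).source) (v : TangentSp y) :
    fderiv ℝ (localRep f a b) (chart a y) (tchart a y v) = tchart b (f y) (tmap f y v) := by
  have h1 := hf.fderiv_localRep_comp isSmooth_id (a := y) (b := a) (c := b) (mem_source y) hy hb
  have h2 := isSmooth_id.fderiv_localRep_comp hf (a := y) (b := f y) (c := b) (mem_source y)
    (mem_source (f y)) hb
  exact DFunLike.congr_fun (h1.symm.trans h2) v

/-- Smoothness may be checked at each point in the preferred charts there. -/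
lemma isSmooth_of_forall_contDiffAt {f : M → N}
    (ho : ∀ x, chartImage x (f ⁻¹' (chart (f x)).source) ∈ nhds (chart x x))
    (hs : ∀ x, ContDiffAt ℝ ∞ (localRep f x (f x)) (chart x x)) : IsSmooth f := by
  intro a b
  have key : ∀ p ∈ chartImage a (f ⁻¹' (chart b).source),
      chartImage a (f ⁻¹' (chart b).source) ∈ nhds p ∧ ContDiffAt ℝ ∞ (localRep f a b) p := by
    intro p hp
    set x := (chart a).symm p with hx
    have hxa : x ∈ (chart a).source := (chart a).map_target hp.1
    have hpx : chart a x = p := (chart a).right_inv hp.1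
    -- near `p`, the representative in the charts at `a` and `b` is the one in the preferred charts,
    -- composed with transition maps on both sides
    have h1 : ContDiffAt ℝ ∞ (localRep id a x) p := by
      rw [← hpx]
      exact isSmooth_id.contDiffAt_localRep hxa (mem_source x)
    have e1 : localRep id a x p = chart x x := rfl
    have h2 : ContDiffAt ℝ ∞ (localRep f x (f x)) (localRep id a x p) := e1 ▸ hs x
    have e2 : (localRep f x (f x) ∘ localRep id a x) p = chart (f x) (f x) := by
      rw [Function.comp_apply, e1, localRep_apply f x (f x) (mem_source x)]
    have h3 : ContDiffAt ℝ ∞ (localRep id (f x) b) ((localRep f x (f x) ∘ localRep id a x) p) := by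
      rw [e2]
      exact isSmooth_id.contDiffAt_localRep (mem_source (f x)) hp.2
    have n1 : ∀ᶠ q in nhds p, q ∈ chartImage a (chart x).source :=
      (isOpen_overlap a x).mem_nhds ⟨hp.1, mem_source x⟩
    have n2 : ∀ᶠ q in nhds p, localRep id a x q ∈ chartImage x (f ⁻¹' (chart (f x)).source) :=
      h1.continuousAt.eventually (e1 ▸ ho x)
    have n3 : ∀ᶠ q in nhds p, (localRep f x (f x) ∘ localRep id a x) q ∈
        chartImage (f x) (chart b).source :=
      (h2.comp p h1).continuousAt.eventually (e2 ▸ (isOpen_overlap (f x) b).mem_nhds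
        (mem_chartImage (mem_source (f x)) hp.2))
    have n4 : ∀ᶠ q in nhds p, q ∈ chartImage a (f ⁻¹' (chart b).source) ∧
        (localRep id (f x) b ∘ localRep f x (f x) ∘ localRep id a x) q = localRep f a b q := by
      filter_upwards [n1, n2, n3] with q h1 h2 h3
      have e3 : (localRep f x (f x) ∘ localRep id a x) q = chart (f x) (f ((chart a).symm q)) :=
        localRep_apply f x (f x) h1.2
      have hq : f ((chart a).symm q) ∈ (chart (f x)).source := by
        have := h2.2
        rw [Set.mem_preimage] at this
        have e : (chart x).symm (localRep id a x q) = (chart a).symm q := (chart x).left_inv h1.2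
        rw [e] at this
        exact this
      refine ⟨⟨h1.1, ?_⟩, ?_⟩
      · have := h3.2
        rw [e3, Set.mem_preimage, (chart (f x)).left_inv hq] at this
        exact this
      · rw [Function.comp_apply, e3]
        exact localRep_apply id (f x) b hq
    exact ⟨n4.mono fun q h => h.1,
      (h3.comp p (h2.comp p h1)).congr_of_eventuallyEq (n4.mono fun q h => h.2.symm)⟩
  exact ⟨isOpen_iff_mem_nhds.2 fun p hp => (key p hp).1,
    fun p hp => (key p hp).2.contDiffWithinAt⟩

end BanachManifold

/-! ### Calculus of families of operators -/

section OperatorCalculus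

/-- A family of operators which is jointly smooth as a function of the parameter and the vector is
smooth for the operator norm, because it is the partial derivative in the direction of the
vector. -/
lemma contDiffOn_clm_of_apply {E F G : Type*} [NormedAddCommGroup E] [NormedSpace ℝ E]
    [NormedAddCommGroup F] [NormedSpace ℝ F] [NormedAddCommGroup G] [NormedSpace ℝ G]
    {A : E → F →L[ℝ] G} {U : Set E} (hU : IsOpen U)
    (hA : ContDiffOn ℝ ∞ (fun q : E × F => A q.1 q.2) (U ×ˢ Set.univ)) : ContDiffOn ℝ ∞ A U := by
  have h1 := hA.fderiv_of_isOpen (m := ∞) (hU.prod isOpen_univ) (by simp)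
  have h2 : ContDiffOn ℝ ∞ (fun p : E => (fderiv ℝ (fun q : E × F => A q.1 q.2) (p, 0)).comp
      (ContinuousLinearMap.inr ℝ E F)) U :=
    (h1.comp (contDiff_id.prodMk contDiff_const).contDiffOn fun p hp => ⟨hp, trivial⟩).clm_comp
      contDiffOn_const
  refine h2.congr fun p hp => ?_
  have h3 : HasFDerivAt (fun q : E × F => A q.1 q.2) (fderiv ℝ (fun q : E × F => A q.1 q.2) (p, 0))
      (p, 0) :=
    ((hA (p, 0) ⟨hp, trivial⟩).contDiffAt ((hU.prod isOpen_univ).mem_nhds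
      ⟨hp, trivial⟩)).differentiableAt (by simp) |>.hasFDerivAt
  have h4 := h3.comp (0 : F) (hasFDerivAt_prodMk_right p (0 : F))
  exact ((A p).hasFDerivAt (x := 0)).unique h4

lemma hasFDerivAt_clm_uncurry {E F G : Type*} [NormedAddCommGroup E] [NormedSpace ℝ E]
    [NormedAddCommGroup F] [NormedSpace ℝ F] [NormedAddCommGroup G] [NormedSpace ℝ G]
    {A : E → F →L[ℝ] G} {p : E} (hA : DifferentiableAt ℝ A p) (x : F) :
    HasFDerivAt (fun q : E × F => A q.1 q.2)
      ((A p).comp (ContinuousLinearMap.snd ℝ E F) +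
        ((fderiv ℝ A p).comp (ContinuousLinearMap.fst ℝ E F)).flip x) (p, x) :=
  (hA.hasFDerivAt.comp (p, x) (hasFDerivAt_fst (𝕜 := ℝ) (p := (p, x)))).clm_apply
    (hasFDerivAt_snd (𝕜 := ℝ) (p := (p, x)))

lemma fderiv_add_clm_apply {E F G : Type*} [NormedAddCommGroup E] [NormedSpace ℂ E]
    [NormedAddCommGroup F] [NormedSpace ℂ F] [NormedAddCommGroup G] [NormedSpace ℂ G]
    (i : E →L[ℂ] G) (k : F →L[ℂ] G) {T : E →L[ℂ] F} {x : E} {L : (E →L[ℂ] F) × E →L[ℝ] G}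
    (hL : HasFDerivAt (fun q : (E →L[ℂ] F) × E => i q.2 + k (q.1 q.2)) L (T, x))
    (X : E →L[ℂ] F) (v : E) : L (X, v) = i v + k (T v + X x) := by
  have h1 := (isBoundedBilinearMap_apply (𝕜 := ℂ) (E := E) (F := F)).hasFDerivAt (T, x)
  have h2 := k.hasFDerivAt.comp (T, x) h1
  have h3 := i.hasFDerivAt.comp (T, x) (hasFDerivAt_snd (𝕜 := ℂ))
  exact DFunLike.congr_fun (hL.unique ((h3.add h2).restrictScalars ℝ)) (X, v)

variable {G E F E' : Type*} [NormedAddCommGroup G] [NormedSpace ℝ G]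
  [NormedAddCommGroup E] [NormedSpace ℂ E] [NormedAddCommGroup F] [NormedSpace ℂ F]
  [NormedAddCommGroup E'] [NormedSpace ℂ E']

lemma ContDiffOn.complex_clm_comp {A : G → F →L[ℂ] E'} {B : G → E →L[ℂ] F} {s : Set G}
    (hA : ContDiffOn ℝ ∞ A s) (hB : ContDiffOn ℝ ∞ B s) :
    ContDiffOn ℝ ∞ (fun g => (A g).comp (B g)) s :=
  ((isBoundedBilinearMap_comp (𝕜 := ℂ) (E := E) (F := F) (G := E')).contDiff.restrict_scalars
    ℝ).comp_contDiffOn (hA.prodMk hB)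

lemma ContDiffOn.complex_clm_inverse [CompleteSpace E] {A : G → E →L[ℂ] F} {s : Set G}
    (hA : ContDiffOn ℝ ∞ A s) (hi : ∀ g ∈ s, (A g).IsInvertible) :
    ContDiffOn ℝ ∞ (fun g => (A g).inverse) s := fun g hg =>
  ((hi g hg).contDiffAt_map_inverse.restrict_scalars ℝ).comp_contDiffWithinAt g (hA g hg)

lemma isInvertible_restrictScalars {A : E →L[ℂ] F} (hA : A.IsInvertible) :
    (A.restrictScalars ℝ).IsInvertible := by
  obtain ⟨e, rfl⟩ := hA
  exact ⟨ContinuousLinearEquiv.equivOfInverse ((e : E →L[ℂ] F).restrictScalars ℝ)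
    ((e.symm : F →L[ℂ] E).restrictScalars ℝ) e.symm_apply_apply e.apply_symm_apply, rfl⟩

lemma inverse_restrictScalars_apply {A : E →L[ℂ] F} (hA : A.IsInvertible) (y : F) :
    (A.restrictScalars ℝ).inverse y = A.inverse y :=
  (isInvertible_restrictScalars hA).inverse_apply_eq.2 (hA.self_apply_inverse y).symm

end OperatorCalculus

section Adjoint

variable {G E F : Type*} [NormedAddCommGroup G] [NormedSpace ℝ G]
  [NormedAddCommGroup E] [InnerProductSpace ℂ E] [CompleteSpace E]
  [NormedAddCommGroup F] [InnerProductSpace ℂ F] [CompleteSpace F]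

lemma contDiff_adjoint :
    ContDiff ℝ ∞ fun A : E →L[ℂ] F => ContinuousLinearMap.adjoint A := by
  refine IsBoundedLinearMap.contDiff (𝕜 := ℝ) ⟨⟨fun A B => map_add _ A B, fun c A => ?_⟩,
    1, one_pos, fun A => ?_⟩
  · have h := map_smulₛₗ (ContinuousLinearMap.adjoint (𝕜 := ℂ) (E := E) (F := F)) (c : ℂ) A
    rw [Complex.conj_ofReal] at h
    exact h
  · rw [one_mul]
    exact (LinearIsometryEquiv.norm_map _ A).le

lemma ContDiffOn.clm_adjoint {A : G → E →L[ℂ] F} {s : Set G} (hA : ContDiffOn ℝ ∞ A s) :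
    ContDiffOn ℝ ∞ (fun g => ContinuousLinearMap.adjoint (A g)) s :=
  contDiff_adjoint.comp_contDiffOn hA

end Adjoint

namespace Gr

variable {H : Hilb.{u}} {E : Type u} [NormedAddCommGroup E] [InnerProductSpace ℂ E]
  [CompleteSpace E] {J : E →L[ℂ] H} {W : Gr H}

lemma Param.adjoint_comp_self_eq (hJ : Param J W) : ∃ e : E ≃L[ℂ] W.1,
    (∀ x, (e x : H) = J x) ∧ ContinuousLinearMap.adjoint J =
      (ContinuousLinearMap.adjoint (e : E →L[ℂ] W.1)).comp W.p := by
  obtain ⟨e, he⟩ := hJ.equiv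
  refine ⟨e, he, ?_⟩
  have h1 : J = W.1.subtypeL.comp (e : E →L[ℂ] W.1) := by
    ext x
    exact (he x).symm
  conv_lhs => rw [h1]
  rw [ContinuousLinearMap.adjoint_comp, Submodule.adjoint_subtypeL]
  rfl

lemma isInvertible_adjoint {E F : Type*}
    [NormedAddCommGroup E] [InnerProductSpace ℂ E] [CompleteSpace E]
    [NormedAddCommGroup F] [InnerProductSpace ℂ F] [CompleteSpace F] (e : E ≃L[ℂ] F) :
    (ContinuousLinearMap.adjoint (e : E →L[ℂ] F)).IsInvertible := by
  refine ⟨ContinuousLinearEquiv.equivOfInverse (ContinuousLinearMap.adjoint (e : E →L[ℂ] F))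
    (ContinuousLinearMap.adjoint (e.symm : F →L[ℂ] E)) (fun x => ?_) (fun x => ?_), rfl⟩
  · rw [← ContinuousLinearMap.comp_apply, ← ContinuousLinearMap.adjoint_comp]
    simp [ContinuousLinearMap.adjoint_id]
  · rw [← ContinuousLinearMap.comp_apply, ← ContinuousLinearMap.adjoint_comp]
    simp [ContinuousLinearMap.adjoint_id]

lemma Param.isInvertible_adjoint_comp_self (hJ : Param J W) :
    ((ContinuousLinearMap.adjoint J).comp J).IsInvertible := by
  obtain ⟨e, he, h⟩ := hJ.adjoint_comp_self_eq
  have h2 : W.p.comp J = (e : E →L[ℂ] W.1) := by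
    ext x
    rw [ContinuousLinearMap.comp_apply, ← he x, W.p_coe]
    rfl
  rw [h, ContinuousLinearMap.comp_assoc, h2]
  exact (isInvertible_adjoint e).comp ⟨e, rfl⟩

/-- The orthogonal projection onto the range of `J` is `J (J† J)⁻¹ J†`. -/
lemma Param.starProjection_eq (hJ : Param J W) :
    W.1.subtypeL.comp W.p = J.comp (((ContinuousLinearMap.adjoint J).comp J).inverse.comp
      (ContinuousLinearMap.adjoint J)) := by
  obtain ⟨e, he, h⟩ := hJ.adjoint_comp_self_eq
  ext x
  obtain ⟨y, hy⟩ := e.surjective (W.p x)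
  have h1 : ContinuousLinearMap.adjoint J x = (ContinuousLinearMap.adjoint J).comp J y := by
    rw [h]
    simp only [ContinuousLinearMap.comp_apply]
    rw [← he, W.p_coe, hy]
  simp only [ContinuousLinearMap.comp_apply] at h1 ⊢
  rw [h1]
  have h2 := hJ.isInvertible_adjoint_comp_self.inverse_apply_self y
  simp only [ContinuousLinearMap.comp_apply] at h2
  rw [h2, ← he, hy]
  rfl

end Gr

/-! ### Bundle morphisms and connections in local trivializations -/

namespace Herm

variable {D D' : Herm.{u}} (Θ : Hom D D')

/-- The action of a bundle morphism on the fibers, in the trivializations around `z` and `z'`, as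
a function of the coordinates of the base point in the chart at `z`. -/
def Hom.localFib (z : D.Base) (z' : D'.Base) (p : Model z) : D.Fiber z →L[ℂ] D'.Fiber z' :=
  (D'.triv z' (Θ.base ((chart z).symm p))).comp
    ((Θ.fib ((chart z).symm p) : D.Fiber _ →L[ℂ] D'.Fiber _).comp
      (D.triv z ((chart z).symm p)).inverse)

/-- The operator family `Hom.localFib` regarded as a family of real linear operators. -/
def Hom.localFibReal (z : D.Base) (z' : D'.Base) (p : Model z) : D.Fiber z →L[ℝ] D'.Fiber z' :=
  (Θ.localFib z z' p).restrictScalars ℝ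

/-- The domain on which the charts at `z` and `z'` represent a bundle morphism. -/
def Hom.localDom (z : D.Base) (z' : D'.Base) : Set (Model z) :=
  chartImage z (D.dom z ∩ Θ.base ⁻¹' ((chart z').source ∩ D'.dom z'))

lemma Hom.chartImage_total (ξ : D.Total) (η : D'.Total) :
    chartImage ξ (Θ.total ⁻¹' (chart η).source) =
      Θ.localDom ξ.1 η.1 ×ˢ (Set.univ : Set (D.Fiber ξ.1)) := by
  ext ⟨p, x⟩
  constructor
  · rintro ⟨⟨⟨h1, h2⟩, -⟩, h3⟩
    exact ⟨⟨h1, h2, h3⟩, trivial⟩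
  · rintro ⟨⟨h1, h2, h3⟩, -⟩
    exact ⟨⟨⟨h1, h2⟩, trivial⟩, h3⟩

lemma Hom.isOpen_localDom (z : D.Base) (z' : D'.Base) : IsOpen (Θ.localDom z z') := by
  have h : IsOpen (Θ.localDom z z' ×ˢ (Set.univ : Set (D.Fiber z))) :=
    Eq.mp (congrArg IsOpen (Θ.chartImage_total ⟨z, 0⟩ ⟨z', 0⟩)) (Θ.isSmooth ⟨z, 0⟩ ⟨z', 0⟩).1
  have h2 : Continuous fun p : Model z => (p, (0 : D.Fiber z)) := by fun_prop
  have h3 := IsOpen.preimage h2 h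
  convert h3 using 1
  ext p
  exact ⟨fun hp => ⟨hp, trivial⟩, fun hp => hp.1⟩

lemma Hom.chart_mem_localDom (z : D.Base) : chart z z ∈ Θ.localDom z (Θ.base z) :=
  chart_mem_chartImage z _ ⟨D.mem_dom z, mem_source _, D'.mem_dom _⟩

lemma Hom.contDiffOn_localRep_total (z : D.Base) (z' : D'.Base) :
    ContDiffOn ℝ ∞ (fun q : Model z × D.Fiber z =>
      (localRep Θ.base z z' q.1, Θ.localFib z z' q.1 q.2)) (Θ.localDom z z' ×ˢ Set.univ) := by
  exact Eq.mp (congrArg (ContDiffOn ℝ ∞ _) (Θ.chartImage_total ⟨z, 0⟩ ⟨z', 0⟩))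
    (Θ.isSmooth ⟨z, 0⟩ ⟨z', 0⟩).2

lemma Hom.contDiffOn_localFibReal (z : D.Base) (z' : D'.Base) :
    ContDiffOn ℝ ∞ (Θ.localFibReal z z') (Θ.localDom z z') :=
  contDiffOn_clm_of_apply (Θ.isOpen_localDom z z')
    (contDiff_snd.comp_contDiffOn (Θ.contDiffOn_localRep_total z z'))

lemma Hom.contDiffOn_localRep_base (z : D.Base) (z' : D'.Base) :
    ContDiffOn ℝ ∞ (localRep Θ.base z z') (Θ.localDom z z') :=
  (Θ.isSmooth_base z z').2.mono fun _ hp => ⟨hp.1, hp.2.2.1⟩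

lemma isInvertible_inverse {E F : Type*} [NormedAddCommGroup E] [NormedSpace ℂ E]
    [NormedAddCommGroup F] [NormedSpace ℂ F] {A : E →L[ℂ] F} (hA : A.IsInvertible) :
    A.inverse.IsInvertible := by
  obtain ⟨e, rfl⟩ := hA
  exact ⟨e.symm, (ContinuousLinearMap.inverse_equiv e).symm⟩

lemma Hom.localFib_isInvertible {z : D.Base} {z' : D'.Base} {p : Model z}
    (hp : p ∈ Θ.localDom z z') : (Θ.localFib z z' p).IsInvertible :=
  (D'.triv_invertible _ _ hp.2.2.2).comp
    (ContinuousLinearMap.IsInvertible.comp ⟨Θ.fib _, rfl⟩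
      (isInvertible_inverse (D.triv_invertible _ _ hp.2.1)))

/-- The derivative of the local representative of a bundle morphism. -/
lemma Hom.hasFDerivAt_localRep_total {z : D.Base} {z' : D'.Base} {p : Model z}
    (hp : p ∈ Θ.localDom z z') (x : D.Fiber z) :
    HasFDerivAt (fun q : Model z × D.Fiber z =>
      (localRep Θ.base z z' q.1, Θ.localFib z z' q.1 q.2))
      (((fderiv ℝ (localRep Θ.base z z') p).comp (ContinuousLinearMap.fst ℝ _ _)).prod
        ((Θ.localFibReal z z' p).comp (ContinuousLinearMap.snd ℝ _ _) +
          ((fderiv ℝ (Θ.localFibReal z z') p).comp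
            (ContinuousLinearMap.fst ℝ (Model z) (D.Fiber z))).flip x))
      (p, x) := by
  have hn := (Θ.isOpen_localDom z z').mem_nhds hp
  have h1 : DifferentiableAt ℝ (localRep Θ.base z z') p :=
    ((Θ.contDiffOn_localRep_base z z').contDiffAt hn).differentiableAt (by simp)
  have h2 : DifferentiableAt ℝ (Θ.localFibReal z z') p :=
    ((Θ.contDiffOn_localFibReal z z').contDiffAt hn).differentiableAt (by simp)
  exact (h1.hasFDerivAt.comp (p, x) (hasFDerivAt_fst (𝕜 := ℝ) (p := (p, x)))).prodMk
    (hasFDerivAt_clm_uncurry h2 x)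

lemma Hom.fderiv_localRep_total_apply (ξ : D.Total) (η : D'.Total) {p : Model ξ.1}
    (hp : p ∈ Θ.localDom ξ.1 η.1) (x : D.Fiber ξ.1) (X : Model ξ.1) (v : D.Fiber ξ.1) :
    (fderiv ℝ (localRep Θ.total ξ η) (p, x) (X, v) : Model η.1 × D'.Fiber η.1) =
      (fderiv ℝ (localRep Θ.base ξ.1 η.1) p X,
        Θ.localFib ξ.1 η.1 p v + fderiv ℝ (Θ.localFibReal ξ.1 η.1) p X x) :=
  DFunLike.congr_fun (Θ.hasFDerivAt_localRep_total hp x).fderiv (X, v)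

/-- The action of a bundle morphism on the fiber over `z`, in the trivializations around `z` and
its image. -/
def Hom.fibCoord (z : D.Base) : D.Fiber z →L[ℂ] D'.Fiber (Θ.base z) :=
  Θ.localFib z (Θ.base z) (chart z z)

/-- The derivative in the direction `X ∈ T_z Z` of the action of a bundle morphism on the
fibers, in the trivializations around `z` and its image. -/
def Hom.fibDeriv (z : D.Base) (X : TangentSp z) : D.Fiber z →L[ℝ] D'.Fiber (Θ.base z) :=
  fderiv ℝ (Θ.localFibReal z (Θ.base z)) (chart z z) X

lemma Hom.fibCoord_isInvertible (z : D.Base) : (Θ.fibCoord z).IsInvertible :=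
  Θ.localFib_isInvertible (Θ.chart_mem_localDom z)

/-- The derivative of a family of complex linear operators is complex linear. -/
lemma Hom.fibDeriv_smul (z : D.Base) (X : TangentSp z) (c : ℂ) (x : D.Fiber z) :
    Θ.fibDeriv z X (c • x) = c • Θ.fibDeriv z X x := by
  have h2 : DifferentiableAt ℝ (Θ.localFibReal z (Θ.base z)) (chart z z) :=
    ((Θ.contDiffOn_localFibReal z _).contDiffAt
      ((Θ.isOpen_localDom z _).mem_nhds (Θ.chart_mem_localDom z))).differentiableAt (by simp)
  have h3 : ∀ y : D.Fiber z, HasFDerivAt (fun p => Θ.localFibReal z (Θ.base z) p y)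
      ((fderiv ℝ (Θ.localFibReal z (Θ.base z)) (chart z z)).flip y) (chart z z) := fun y => by
    have := h2.hasFDerivAt.clm_apply (hasFDerivAt_const y (chart z z))
    simpa using this
  have h4 := (h3 x).const_smul c
  have h5 : (fun p => Θ.localFibReal z (Θ.base z) p (c • x)) =
      c • fun p => Θ.localFibReal z (Θ.base z) p x := by
    funext p
    exact (Θ.localFib z (Θ.base z) p).map_smul c x
  exact DFunLike.congr_fun ((h5 ▸ h3 (c • x)).unique h4) X

/-- The tangent map of a bundle morphism: the first component does not depend on the fiber
direction, and the second one is linear in the point of the fiber and the fiber direction. -/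
lemma Hom.tmap_total (z : D.Base) (x : D.Fiber z) (X : TangentSp z) (v : D.Fiber z) :
    tmap Θ.total ⟨z, x⟩ (tvec ⟨z, x⟩ X v) =
      tvec (Θ.total ⟨z, x⟩) (tmap Θ.base z X)
        (Θ.fibCoord z v + Θ.fibDeriv z X (D.triv z z x)) :=
  Θ.fderiv_localRep_total_apply ⟨z, x⟩ (Θ.total ⟨z, x⟩) (Θ.chart_mem_localDom z) (D.triv z z x) X v

lemma Hom.tmap_total_vertical (ξ : D.Total) (v : D.Fiber ξ.1) :
    tmap Θ.total ξ (tvec ξ 0 v) = tvec (Θ.total ξ) 0 (Θ.fibCoord ξ.1 v) := by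
  obtain ⟨z, x⟩ := ξ
  rw [Θ.tmap_total]
  have h1 : tmap Θ.base z 0 = 0 := map_zero _
  have h2 : Θ.fibDeriv z 0 = 0 := map_zero _
  rw [h1, h2]
  congr 1
  exact add_zero _

/-- The component in the base direction of a tangent vector to the total space at `ξ`. -/
def tbase {ξ : D.Total} (v : TangentSp ξ) : TangentSp ξ.1 := v.1

lemma tvec_tbase_tfib {ξ : D.Total} (v : TangentSp ξ) : tvec ξ (tbase v) (tfib v) = v := rfl

lemma isSmooth_proj (D : Herm.{u}) : IsSmooth D.proj := by
  refine isSmooth_of_forall_contDiffAt (fun ξ => ?_) (fun ξ => ?_)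
  · refine Filter.mem_of_superset ((isOpen_target ξ).mem_nhds
      ((chart ξ).map_source (mem_source ξ))) ?_
    rintro ⟨p, x⟩ hp
    exact ⟨hp, (chart ξ.1).map_target hp.1.1⟩
  · have h : localRep D.proj ξ (D.proj ξ) =ᶠ[nhds (chart ξ ξ)]
        (Prod.fst : Model ξ.1 × D.Fiber ξ.1 → Model ξ.1) := by
      filter_upwards [(isOpen_target ξ).mem_nhds ((chart ξ).map_source (mem_source ξ))] with q hq
      exact (chart ξ.1).right_inv hq.1.1
    exact ContDiffAt.congr_of_eventuallyEq contDiffAt_fst h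

lemma fderiv_localRep_proj (D : Herm.{u}) (ξ : D.Total) {q : Model ξ} (hq : q ∈ (chart ξ).target) :
    fderiv ℝ (localRep D.proj ξ ξ.1) q = ContinuousLinearMap.fst ℝ (Model ξ.1) (D.Fiber ξ.1) := by
  have h : localRep D.proj ξ ξ.1 =ᶠ[nhds q] (Prod.fst : Model ξ.1 × D.Fiber ξ.1 → Model ξ.1) := by
    filter_upwards [(isOpen_target ξ).mem_nhds hq] with q hq
    exact (chart ξ.1).right_inv hq.1.1
  exact h.fderiv_eq.trans fderiv_fst

lemma tmap_proj (ξ : D.Total) (v : TangentSp ξ) : tmap D.proj ξ v = tbase v :=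
  DFunLike.congr_fun (D.fderiv_localRep_proj ξ ((chart ξ).map_source (mem_source ξ))) v

/-- The charts of the tangent bundle of the total space map vertical vectors to vertical
vectors. -/
lemma tchart_fst {a y : D.Total} (hy : y ∈ (chart a).source) (v : TangentSp y) :
    (tchart a y v).1 = tchart a.1 y.1 (tbase v) := by
  have h := D.isSmooth_proj.fderiv_localRep_tchart (b := a.1) hy (show y.1 ∈ _ from hy.1) v
  rw [D.fderiv_localRep_proj a ((chart a).map_source hy), tmap_proj] at h
  exact h

end Herm

namespace LinearConnection

variable {D : Herm.{u}} (Φ : LinearConnection D)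

lemma tbase_apply (ξ : D.Total) (v : TangentSp ξ) : Herm.tbase (Φ.Φ ξ v) = 0 := by
  have h : Φ.Φ ξ v ∈ Set.range (Φ.Φ ξ) := ⟨v, rfl⟩
  rw [Φ.range_eq_ker, Set.mem_ofPred_eq, Herm.tmap_proj] at h
  exact h

lemma apply_eq (ξ : D.Total) (v : TangentSp ξ) :
    Φ.Φ ξ v = Herm.tvec ξ 0 (Herm.tfib (Φ.Φ ξ v)) := by
  conv_lhs => rw [← Herm.tvec_tbase_tfib (Φ.Φ ξ v), Φ.tbase_apply]

lemma apply_vertical (ξ : D.Total) (v : D.Fiber ξ.1) :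
    Φ.Φ ξ (Herm.tvec ξ 0 v) = Herm.tvec ξ 0 v := by
  have h : Herm.tvec ξ 0 v ∈ Set.range (Φ.Φ ξ) := by
    rw [Φ.range_eq_ker, Set.mem_ofPred_eq, Herm.tmap_proj]
    rfl
  obtain ⟨w, hw⟩ := h
  rw [← hw]
  exact DFunLike.congr_fun (Φ.idem ξ) w

@[ext]
lemma ext {Φ Ψ : LinearConnection D} (h : ∀ ξ v, Herm.tfib (Φ.Φ ξ v) = Herm.tfib (Ψ.Φ ξ v)) :
    Φ = Ψ := by
  have e : Φ.Φ = Ψ.Φ := by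
    funext ξ
    ext v : 1
    rw [Φ.apply_eq, Ψ.apply_eq, h]
  cases Φ
  cases Ψ
  cases e
  rfl

lemma congr_point {z : D.Base} {c d : D.Fiber z} (h : c = d) (X : TangentSp z) (v : D.Fiber z) :
    Herm.tfib (Φ.Φ ⟨z, c⟩ (Herm.tvec ⟨z, c⟩ X v)) =
      Herm.tfib (Φ.Φ ⟨z, d⟩ (Herm.tvec ⟨z, d⟩ X v)) := by
  subst h
  rfl

end LinearConnection

/-! ### Pull-back of linear connections -/

namespace LinearConnection

variable {D D' D'' : Herm.{u}}

/-- The candidate for the pull-back connection: the vertical vector which `Tδ` maps to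
`Φ' (Tδ v)`. -/
def pullbackFun (Θ : Herm.Hom D D') (Φ' : LinearConnection D') (ξ : D.Total) :
    TangentSp ξ →L[ℝ] TangentSp ξ :=
  (ContinuousLinearMap.inr ℝ (Model ξ.1) (D.Fiber ξ.1)).comp
    (((Θ.fibCoord ξ.1).inverse.restrictScalars ℝ).comp
      ((ContinuousLinearMap.snd ℝ (Model (Θ.base ξ.1)) (D'.Fiber (Θ.base ξ.1))).comp
        ((Φ'.Φ (Θ.total ξ)).comp (tmap Θ.total ξ))))

lemma pullbackFun_apply (Θ : Herm.Hom D D') (Φ' : LinearConnection D') (ξ : D.Total)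
    (v : TangentSp ξ) : pullbackFun Θ Φ' ξ v =
      Herm.tvec ξ 0 ((Θ.fibCoord ξ.1).inverse
        (Herm.tfib (Φ'.Φ (Θ.total ξ) (tmap Θ.total ξ v)))) := rfl

lemma tfib_pullbackFun (Θ : Herm.Hom D D') (Φ' : LinearConnection D') (z : D.Base)
    (x : D.Fiber z) (X : TangentSp z) (v : D.Fiber z) :
    Herm.tfib (pullbackFun Θ Φ' ⟨z, x⟩ (Herm.tvec ⟨z, x⟩ X v)) =
      (Θ.fibCoord z).inverse (Herm.tfib (Φ'.Φ ⟨Θ.base z, Θ.fib z x⟩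
        (Herm.tvec ⟨Θ.base z, Θ.fib z x⟩ (tmap Θ.base z X)
          (Θ.fibCoord z v + Θ.fibDeriv z X (D.triv z z x))))) :=
  congrArg (fun w : TangentSp (Θ.total ⟨z, x⟩) => (Θ.fibCoord z).inverse
    (Herm.tfib (Φ'.Φ (Θ.total ⟨z, x⟩) w))) (Θ.tmap_total z x X v)

lemma tmap_pullbackFun (Θ : Herm.Hom D D') (Φ' : LinearConnection D') (ξ : D.Total)
    (v : TangentSp ξ) : tmap Θ.total ξ (pullbackFun Θ Φ' ξ v) =
      Φ'.Φ (Θ.total ξ) (tmap Θ.total ξ v) := by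
  rw [pullbackFun_apply, Θ.tmap_total_vertical]
  exact (congrArg (Herm.tvec (Θ.total ξ) 0)
    ((Θ.fibCoord_isInvertible ξ.1).self_apply_inverse _)).trans (Φ'.apply_eq _ _).symm

lemma pullbackFun_vertical (Θ : Herm.Hom D D') (Φ' : LinearConnection D') (ξ : D.Total)
    (v : D.Fiber ξ.1) : pullbackFun Θ Φ' ξ (Herm.tvec ξ 0 v) = Herm.tvec ξ 0 v := by
  have h : Herm.tfib (Φ'.Φ (Θ.total ξ) (tmap Θ.total ξ (Herm.tvec ξ 0 v))) = Θ.fibCoord ξ.1 v := by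
    rw [Θ.tmap_total_vertical]
    exact congrArg Herm.tfib (Φ'.apply_vertical (Θ.total ξ) (Θ.fibCoord ξ.1 v))
  rw [pullbackFun_apply]
  exact congrArg (Herm.tvec ξ 0) ((congrArg (Θ.fibCoord ξ.1).inverse h).trans
    ((Θ.fibCoord_isInvertible ξ.1).inverse_apply_self v))

/-- In the charts at `a` and `b` the pull-back connection is the second component of the
representative of `Φ'`, composed with the inverse of the action of `Θ` on the fibers. -/
lemma tchart_pullbackFun (Θ : Herm.Hom D D') (Φ' : LinearConnection D') {a : D.Total}
    {b : D'.Total} {q : Model a × Model a}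
    (hq : q.1 ∈ chartImage a (Θ.total ⁻¹' (chart b).source)) :
    tchart a ((chart a).symm q.1)
        (pullbackFun Θ Φ' ((chart a).symm q.1) (tchartSymm a ((chart a).symm q.1) q.2)) =
      ((0, (Θ.localFib a.1 b.1 q.1.1).inverse
        (tchart b ((chart b).symm (localRep Θ.total a b q.1))
          (Φ'.Φ ((chart b).symm (localRep Θ.total a b q.1))
            (tchartSymm b ((chart b).symm (localRep Θ.total a b q.1))
              (fderiv ℝ (localRep Θ.total a b) q.1 q.2)))).2) :
        Model a.1 × D.Fiber a.1) := by
  obtain ⟨q1, q2⟩ := q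
  have hq' : q1.1 ∈ Θ.localDom a.1 b.1 := ((Θ.chartImage_total a b).le hq).1
  set y := (chart a).symm q1 with hy
  have hya : y ∈ (chart a).source := (chart a).map_target hq.1
  have hyq : chart a y = q1 := (chart a).right_inv hq.1
  have hyb : Θ.total y ∈ (chart b).source := hq.2
  have e : (chart b).symm (localRep Θ.total a b q1) = Θ.total y := (chart b).left_inv hyb
  rw [e]
  have hT : ∀ v : TangentSp y, fderiv ℝ (localRep Θ.total a b) q1 (tchart a y v) =
      tchart b (Θ.total y) (tmap Θ.total y v) := fun v => by
    rw [← hyq]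
    exact (Herm.Hom.isSmooth Θ).fderiv_localRep_tchart hya hyb v
  have h1 : tchartSymm b (Θ.total y) (fderiv ℝ (localRep Θ.total a b) q1 q2) =
      tmap Θ.total y (tchartSymm a y q2) := by
    conv_lhs => rw [← tchart_tchartSymm hya q2, hT, tchartSymm_tchart hyb]
  rw [h1, ← tmap_pullbackFun, ← hT]
  set w := tchart a y (pullbackFun Θ Φ' y (tchartSymm a y q2)) with hw
  have hw1 : w.1 = 0 := by
    rw [hw, Herm.tchart_fst hya, pullbackFun_apply]
    exact map_zero _
  refine Prod.ext hw1 ?_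
  have h2 := Θ.fderiv_localRep_total_apply a b hq' q1.2 w.1 w.2
  have h3 : (fderiv ℝ (localRep Θ.total a b) q1 w).2 = Θ.localFib a.1 b.1 q1.1 w.2 := by
    refine (congrArg Prod.snd h2).trans ?_
    have h4 : fderiv ℝ (Θ.localFibReal a.1 b.1) q1.1 0 = 0 := _root_.map_zero _
    rw [hw1, h4]
    exact add_zero (Θ.localFib a.1 b.1 q1.1 w.2)
  change w.2 = (Θ.localFib a.1 b.1 q1.1).inverse (fderiv ℝ (localRep Θ.total a b) q1 w).2
  rw [h3, (Θ.localFib_isInvertible hq').inverse_apply_self]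

lemma isSmooth_pullbackFun (Θ : Herm.Hom D D') (Φ' : LinearConnection D') :
    IsSmoothTangentEndo (pullbackFun Θ Φ') := by
  rintro a ⟨q1, q2⟩ hq
  set b := Θ.total ((chart a).symm q1) with hb
  set O := chartImage a (Θ.total ⁻¹' (chart b).source) with hO
  have hsm := Herm.Hom.isSmooth Θ a b
  have hq1 : q1 ∈ O := ⟨hq.1, mem_source b⟩
  have hf : ContDiffOn ℝ ∞ (localRep Θ.total a b) O := hsm.2
  have hOo : IsOpen O := hsm.1
  have hdf : ContDiffOn ℝ ∞ (fun q : Model a × Model a =>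
      fderiv ℝ (localRep Θ.total a b) q.1 q.2) (O ×ˢ Set.univ) :=
    ((hf.fderiv_of_isOpen (m := ∞) hOo (by simp)).comp contDiffOn_fst fun q hq => hq.1).clm_apply
      contDiffOn_snd
  have hpair : ContDiffOn ℝ ∞ (fun q : Model a × Model a =>
      (localRep Θ.total a b q.1, fderiv ℝ (localRep Θ.total a b) q.1 q.2)) (O ×ˢ Set.univ) :=
    (hf.comp contDiffOn_fst fun q hq => hq.1).prodMk hdf
  have hN := (Φ'.isSmooth b).comp hpair fun q hq =>
    ⟨(chart b).map_source hq.1.2, trivial⟩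
  have hN2 := (contDiff_snd (𝕜 := ℝ) (n := ∞) (E := Model b.1)
    (F := D'.Fiber b.1)).comp_contDiffOn hN
  have hA : ContDiffOn ℝ ∞ (fun q : Model a × Model a =>
      (Θ.localFibReal a.1 b.1 q.1.1).inverse) (O ×ˢ Set.univ) := by
    rintro q ⟨hq, -⟩
    have hq' : q.1.1 ∈ Θ.localDom a.1 b.1 := ((Θ.chartImage_total a b).le hq).1
    have hi : (Θ.localFibReal a.1 b.1 q.1.1).IsInvertible :=
      isInvertible_restrictScalars (Θ.localFib_isInvertible hq')
    have h1 : ContDiffAt ℝ ∞ (Θ.localFibReal a.1 b.1) q.1.1 :=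
      (Θ.contDiffOn_localFibReal a.1 b.1).contDiffAt ((Θ.isOpen_localDom _ _).mem_nhds hq')
    have h2 : ContDiffAt ℝ ∞ (fun q : (Model a.1 × D.Fiber a.1) × (Model a.1 × D.Fiber a.1) =>
        q.1.1) q := (contDiff_fst.comp contDiff_fst).contDiffAt
    exact (hi.contDiffAt_map_inverse.comp (f := fun q : (Model a.1 × D.Fiber a.1) ×
      (Model a.1 × D.Fiber a.1) => Θ.localFibReal a.1 b.1 q.1.1) q
        (h1.comp (f := fun q : (Model a.1 × D.Fiber a.1) ×
      (Model a.1 × D.Fiber a.1) => q.1.1) q h2)).contDiffWithinAt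
  have hmain : ContDiffOn ℝ ∞ (fun q : Model a × Model a =>
      ((0, (Θ.localFibReal a.1 b.1 q.1.1).inverse
        (tchart b ((chart b).symm (localRep Θ.total a b q.1))
          (Φ'.Φ ((chart b).symm (localRep Θ.total a b q.1))
            (tchartSymm b ((chart b).symm (localRep Θ.total a b q.1))
              (fderiv ℝ (localRep Θ.total a b) q.1 q.2)))).2) :
        Model a.1 × D.Fiber a.1)) (O ×ˢ Set.univ) :=
    contDiffOn_const.prodMk (hA.clm_apply hN2)
  have hinv : ∀ q : Model a × Model a, q.1 ∈ O → ∀ w : D'.Fiber b.1,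
      (Θ.localFibReal a.1 b.1 q.1.1).inverse w = (Θ.localFib a.1 b.1 q.1.1).inverse w := by
    intro q hq w
    have hq' : q.1.1 ∈ Θ.localDom a.1 b.1 := ((Θ.chartImage_total a b).le hq).1
    exact inverse_restrictScalars_apply (Θ.localFib_isInvertible hq') w
  -- the formula in the charts at `a` and `b` holds on `O`, a neighborhood of the given point
  refine ContDiffAt.contDiffWithinAt ?_
  have hnh : O ×ˢ (Set.univ : Set (Model a)) ∈ nhds (q1, q2) :=
    (hOo.prod isOpen_univ).mem_nhds ⟨hq1, trivial⟩
  refine (hmain.contDiffAt hnh).congr_of_eventuallyEq ?_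
  filter_upwards [hnh] with q hq
  rw [hinv q hq.1]
  exact tchart_pullbackFun Θ Φ' hq.1

/-- The pull-back `Θ^*(Φ')` of a linear connection through a bundle morphism. -/
def pullback (Θ : Herm.Hom D D') (Φ' : LinearConnection D') : LinearConnection D where
  Φ := pullbackFun Θ Φ'
  isSmooth := isSmooth_pullbackFun Θ Φ'
  idem ξ := by
    ext v : 1
    exact pullbackFun_vertical Θ Φ' ξ _
  range_eq_ker ξ := by
    ext v
    rw [Set.mem_ofPred_eq, Herm.tmap_proj]
    constructor
    · rintro ⟨w, rfl⟩
      rfl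
    · intro hv
      have e : v = Herm.tvec ξ 0 (Herm.tfib v) :=
        (Herm.tvec_tbase_tfib v).symm.trans (congrArg (fun X => Herm.tvec ξ X (Herm.tfib v)) hv)
      refine ⟨v, ?_⟩
      rw [e]
      exact pullbackFun_vertical Θ Φ' ξ _
  map_add z X x y v w := by
    have h := Φ'.map_add (Θ.base z) (tmap Θ.base z X) (Θ.fib z x) (Θ.fib z y)
      (Θ.fibCoord z v + Θ.fibDeriv z X (D.triv z z x))
      (Θ.fibCoord z w + Θ.fibDeriv z X (D.triv z z y))
    rw [← Φ'.congr_point (_root_.map_add (Θ.fib z) x y)] at h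
    have e : Θ.fibCoord z (v + w) + Θ.fibDeriv z X (D.triv z z (x + y)) =
        (Θ.fibCoord z v + Θ.fibDeriv z X (D.triv z z x)) +
          (Θ.fibCoord z w + Θ.fibDeriv z X (D.triv z z y)) := by
      rw [_root_.map_add, _root_.map_add, _root_.map_add]
      abel
    rw [← e] at h
    simp only [tfib_pullbackFun]
    refine (congrArg (Θ.fibCoord z).inverse h).trans ?_
    exact _root_.map_add _ _ _
  map_smul z X c x v := by
    have h := Φ'.map_smul (Θ.base z) (tmap Θ.base z X) c (Θ.fib z x)
      (Θ.fibCoord z v + Θ.fibDeriv z X (D.triv z z x))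
    rw [← Φ'.congr_point (_root_.map_smul (Θ.fib z) c x)] at h
    have e : Θ.fibCoord z (c • v) + Θ.fibDeriv z X (D.triv z z (c • x)) =
        c • (Θ.fibCoord z v + Θ.fibDeriv z X (D.triv z z x)) := by
      rw [_root_.map_smul, _root_.map_smul, Θ.fibDeriv_smul, smul_add]
    rw [← e] at h
    simp only [tfib_pullbackFun]
    refine (congrArg (Θ.fibCoord z).inverse h).trans ?_
    exact _root_.map_smul _ _ _

lemma isPullbackConnection_pullback (Θ : D ⟶ D') (Φ' : LinearConnection D') :
    IsPullbackConnection Θ (pullback Θ Φ') Φ' := fun ξ => by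
  ext v : 1
  exact tmap_pullbackFun Θ Φ' ξ v

lemma isPullbackConnection_unique {Θ : D ⟶ D'} {Φ Ψ : LinearConnection D}
    {Φ' : LinearConnection D'} (h1 : IsPullbackConnection Θ Φ Φ')
    (h2 : IsPullbackConnection Θ Ψ Φ') : Φ = Ψ := by
  ext ξ v
  have h3 : tmap Θ.total ξ (Φ.Φ ξ v) = tmap Θ.total ξ (Ψ.Φ ξ v) :=
    DFunLike.congr_fun ((h1 ξ).trans (h2 ξ).symm) v
  rw [Φ.apply_eq, Ψ.apply_eq, Herm.Hom.tmap_total_vertical, Herm.Hom.tmap_total_vertical] at h3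
  obtain ⟨e, he⟩ := Herm.Hom.fibCoord_isInvertible Θ ξ.1
  have h4 : Herm.Hom.fibCoord Θ ξ.1 (Herm.tfib (Φ.Φ ξ v)) =
      Herm.Hom.fibCoord Θ ξ.1 (Herm.tfib (Ψ.Φ ξ v)) := congrArg Prod.snd h3
  rw [← he] at h4
  exact e.injective h4

lemma isPullbackConnection_comp {Θ : D ⟶ D'} {Θ' : D' ⟶ D''} {Φ : LinearConnection D}
    {Φ' : LinearConnection D'} {Φ'' : LinearConnection D''} (h1 : IsPullbackConnection Θ Φ Φ')
    (h2 : IsPullbackConnection Θ' Φ' Φ'') : IsPullbackConnection (Θ ≫ Θ') Φ Φ'' :=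
  let f : (⟨D, Φ⟩ : LinConnect.{u}) ⟶ ⟨D', Φ'⟩ := ⟨Θ, h1⟩
  let g : (⟨D', Φ'⟩ : LinConnect.{u}) ⟶ ⟨D'', Φ''⟩ := ⟨Θ', h2⟩
  LinConnect.Hom.pullback (f ≫ g)

end LinearConnection

/-! ### The universal connection -/

namespace Gr

variable {H : Hilb.{u}}

lemma contDiff_starProjection_graph (S : Gr H) :
    ContDiff ℝ ∞ fun T => (S.graph T).1.subtypeL.comp (S.graph T).p := by
  have hJ : ContDiffOn ℝ ∞ S.jmap Set.univ := (S.contDiff_jmap.restrict_scalars ℝ).contDiffOn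
  have h := hJ.complex_clm_comp (((hJ.clm_adjoint.complex_clm_comp hJ).complex_clm_inverse
    fun T _ => (S.param_jmap T).isInvertible_adjoint_comp_self).complex_clm_comp hJ.clm_adjoint)
  rw [← contDiffOn_univ]
  exact h.congr fun T _ => (S.param_jmap T).starProjection_eq

lemma fderiv_p_jmap_apply (S W : Gr H) {T : S.1 →L[ℂ] S.1ᗮ} {x : S.1}
    {L : (S.1 →L[ℂ] S.1ᗮ) × S.1 →L[ℝ] W.1}
    (hL : HasFDerivAt (fun q : (S.1 →L[ℂ] S.1ᗮ) × S.1 => W.p (S.jmap q.1 q.2)) L (T, x))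
    (X : S.1 →L[ℂ] S.1ᗮ) (v : S.1) : L (X, v) = W.p ((X x : H) + S.jmap T v) := by
  refine (fderiv_add_clm_apply (W.p.comp S.1.subtypeL) (W.p.comp S.1ᗮ.subtypeL)
    (hL.congr_of_eventuallyEq (Filter.Eventually.of_forall fun q =>
      (W.p.map_add (q.2 : H) (q.1 q.2 : H)).symm)) X v).trans ?_
  change W.p (v : H) + W.p ((T v + X x : S.1ᗮ) : H) = W.p ((X x : H) + ((v : H) + (T v : H)))
  rw [Submodule.coe_add, map_add, map_add, map_add]
  abel

/-- The second component of the change of charts of the universal bundle, from the chart at `S`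
to the chart at a subspace in its domain. -/
lemma coe_tchartSymm_snd (S : Gr H) (x₀ x : S.1) (T : S.1 →L[ℂ] S.1ᗮ)
    (X : S.1 →L[ℂ] S.1ᗮ) (v : S.1) :
    ((tchartSymm (M := (taut H).Total) (tautPoint S x₀)
      ((chart (M := (taut H).Total) (tautPoint S x₀)).symm (T, x)) (X, v)).2 : (S.graph T).1) =
      (S.graph T).p ((X x : H) + S.jmap T v) := by
  set a : (taut H).Total := tautPoint S x₀ with ha
  set y : (taut H).Total := (chart a).symm (T, x) with hy
  have hT : ((T, x) : Model a) ∈ (chart a).target := ⟨⟨trivial, ⟨T, rfl⟩⟩, trivial⟩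
  have hya : y ∈ (chart a).source := (chart a).map_target hT
  have hay : chart a y = (T, x) := (chart a).right_inv hT
  have h1 : HasFDerivAt (localRep id a y) (tchartSymm a y) ((T, x) : Model a) :=
    Eq.mp (congrArg (HasFDerivAt (localRep id a y) (tchartSymm a y)) hay)
      (hasFDerivAt_tchartSymm hya)
  have h2 : HasFDerivAt (fun q : (S.1 →L[ℂ] S.1ᗮ) × S.1 => (S.graph T).p (S.jmap q.1 q.2))
      ((ContinuousLinearMap.snd ℝ _ _).comp (tchartSymm a y)) (T, x) := by
    have h3 := (hasFDerivAt_snd (𝕜 := ℝ) (E := Model y.1) (F := (taut H).Fiber y.1)).comp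
      ((T, x) : Model a) h1
    refine h3.congr_of_eventuallyEq (Filter.Eventually.of_forall fun q => ?_)
    exact congrArg (S.graph T).p (S.inverse_proj_graph q.1 q.2).symm
  exact S.fderiv_p_jmap_apply (S.graph T) h2 X v

end Gr

/-- The projection of the tangent vectors to the total space onto the fiber direction, in the
chart around their base point. -/
def vertProj {D : Herm.{u}} (ξ : D.Total) : TangentSp ξ →L[ℝ] TangentSp ξ :=
  (ContinuousLinearMap.inr ℝ (Model ξ.1) (D.Fiber ξ.1)).comp
    (ContinuousLinearMap.snd ℝ (Model ξ.1) (D.Fiber ξ.1))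

/-- The universal connection in the chart of the universal bundle at `S`.  The tangent vector
`(X, v)` at the point `x + T x` of the graph `W` of `T` is the velocity `X x + (v + T v)` of a curve
of vectors, which is projected to `W`. -/
lemma tchart_vertProj {H : Hilb.{u}} (S : Gr H) (x₀ x : S.1) (T : S.1 →L[ℂ] S.1ᗮ)
    (X : S.1 →L[ℂ] S.1ᗮ) (v : S.1) :
    tchart (M := (taut H).Total) (tautPoint S x₀)
      ((chart (M := (taut H).Total) (tautPoint S x₀)).symm (T, x))
      (vertProj _ (tchartSymm (M := (taut H).Total) (tautPoint S x₀)
        ((chart (M := (taut H).Total) (tautPoint S x₀)).symm (T, x)) (X, v))) =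
      ((0, S.p ((S.graph T).1.subtypeL.comp (S.graph T).p ((X x : H) + S.jmap T v))) :
        (S.1 →L[ℂ] S.1ᗮ) × S.1) := by
  have h0 := S.coe_tchartSymm_snd x₀ x T X v
  set a : (taut H).Total := tautPoint S x₀ with ha
  set y : (taut H).Total := (chart a).symm (T, x) with hy
  have hT : ((T, x) : Model a) ∈ (chart a).target := ⟨⟨trivial, ⟨T, rfl⟩⟩, trivial⟩
  have hya : y ∈ (chart a).source := (chart a).map_target hT
  set w : TangentSp y := vertProj y (tchartSymm a y (X, v)) with hw
  set n : (S.1 →L[ℂ] S.1ᗮ) × S.1 := tchart a y w with hn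
  have hn1 : n.1 = 0 := (Herm.tchart_fst hya w).trans (map_zero _)
  have h1 := S.coe_tchartSymm_snd x₀ x T n.1 n.2
  have h2 : tchartSymm a y (n.1, n.2) = w := tchartSymm_tchart hya w
  -- `n` and `(X, v)` represent tangent vectors with the same fiber component, and `n.1 = 0`
  have h3 : (S.graph T).p (S.jmap T n.2) = (S.graph T).p ((X x : H) + S.jmap T v) := by
    rw [← h0]
    have e : (n.1 x : H) + S.jmap T n.2 = S.jmap T n.2 := by
      rw [hn1]
      simp
    rw [← e, ← h1]
    have e' := congrArg (fun m : Model y.1 × (taut H).Fiber y.1 => m.2) h2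
    exact e'
  have h4 : (((S.graph T).p (S.jmap T n.2) : (S.graph T).1) : H) = S.jmap T n.2 :=
    congrArg Subtype.val ((S.graph T).p_coe ⟨S.jmap T n.2, ((S.param_jmap T).2 _).2 ⟨_, rfl⟩⟩)
  refine Prod.ext hn1 ?_
  change n.2 = S.p (((S.graph T).p ((X x : H) + S.jmap T v) : (S.graph T).1) : H)
  rw [← h3, h4, S.p_jmap]

lemma isSmooth_vertProj (H : Hilb.{u}) :
    IsSmoothTangentEndo (M := (taut H).Total) vertProj := by
  rintro ⟨S, x₀⟩
  have key : ∀ (S : Gr H), ContDiff ℝ ∞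
      (fun q : ((S.1 →L[ℂ] S.1ᗮ) × S.1) × ((S.1 →L[ℂ] S.1ᗮ) × S.1) =>
        ((0, S.p ((S.graph q.1.1).1.subtypeL.comp (S.graph q.1.1).p
          ((q.2.1 q.1.2 : H) + S.jmap q.1.1 q.2.2))) : (S.1 →L[ℂ] S.1ᗮ) × S.1)) := by
    intro S
    have h1 : ContDiff ℝ ∞ (fun q : ((S.1 →L[ℂ] S.1ᗮ) × S.1) × ((S.1 →L[ℂ] S.1ᗮ) × S.1) =>
        (q.2.1 q.1.2 : H) + S.jmap q.1.1 q.2.2) := by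
      refine ContDiff.restrict_scalars ℝ (𝕜' := ℂ) ?_
      refine ContDiff.add (S.1ᗮ.subtypeL.contDiff.comp ?_) ?_
      · exact (contDiff_fst.comp contDiff_snd).clm_apply (contDiff_snd.comp contDiff_fst)
      · exact (S.contDiff_jmap.comp (contDiff_fst.comp contDiff_fst)).clm_apply
          (contDiff_snd.comp contDiff_snd)
    have h2 : ContDiffOn ℝ ∞ (fun q : ((S.1 →L[ℂ] S.1ᗮ) × S.1) × ((S.1 →L[ℂ] S.1ᗮ) × S.1) =>
        (S.graph q.1.1).1.subtypeL.comp (S.graph q.1.1).p) Set.univ :=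
      (S.contDiff_starProjection_graph.comp (contDiff_fst.comp contDiff_fst)).contDiffOn
    have h3 := contDiffOn_univ.1 (h2.complex_clm_apply h1.contDiffOn)
    exact contDiff_const.prodMk ((S.p.contDiff.restrict_scalars ℝ).comp h3)
  refine (key S).contDiffOn.congr ?_
  rintro ⟨⟨T, x⟩, ⟨X, v⟩⟩ -
  exact tchart_vertProj S x₀ x T X v

/-- The universal connection: in the chart at `S`, the tangent vectors at the points of the fiber
over `S` are mapped to their components in the fiber direction. -/
def univConnection (H : Hilb.{u}) : LinearConnection (taut H) where
  Φ := vertProj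
  isSmooth := isSmooth_vertProj H
  idem _ := rfl
  range_eq_ker ξ := by
    ext v
    rw [Set.mem_ofPred_eq, Herm.tmap_proj]
    constructor
    · rintro ⟨w, rfl⟩
      rfl
    · intro hv
      exact ⟨v, Prod.ext hv.symm rfl⟩
  map_add _ _ _ _ _ _ := rfl
  map_smul _ _ _ _ _ := rfl

lemma Gr.map_p_map_jmap {H H' : Hilb.{u}} (V : H →ₗᵢ[ℂ] H') (S : Gr H) (T : S.1 →L[ℂ] S.1ᗮ)
    (x : S.1) : (S.map V).p (V (S.jmap T x)) = S.mapFib V x := by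
  have h1 : V (T x : H) ∈ (S.map V).1ᗮ := by
    rintro _ ⟨y, hy, rfl⟩
    exact (V.inner_map_map y _).trans ((T x).2 y hy)
  have h2 : (S.map V).p (V (T x : H)) = 0 := (S.map V).p_coe_orthogonal ⟨_, h1⟩
  have h3 : (S.map V).p (V (x : H)) = S.mapFib V x := (S.map V).p_coe (S.mapFib V x)
  change (S.map V).p (V ((x : H) + (T x : H))) = _
  rw [map_add, map_add, h2, h3, add_zero]

/-- The universal connections are natural with respect to linear isometries: in the charts at `S`
and `V S` the action on the fibers is constant. -/
lemma isPullbackConnection_tautMap {H H' : Hilb.{u}} (V : H →ₗᵢ[ℂ] H') :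
    IsPullbackConnection (tautMap V) (univConnection H) (univConnection H') := by
  have h1 : ∀ S : (taut H).Base, Herm.Hom.localFibReal (tautMap V) S
      (Herm.Hom.base (tautMap V) S) = fun _ =>
        (Herm.Hom.fib (tautMap V) S : (taut H).Fiber S →L[ℂ] _).restrictScalars ℝ := by
    intro S
    funext T
    refine ContinuousLinearMap.ext fun y => ?_
    refine Eq.trans ?_ (Gr.map_p_map_jmap V S T y)
    exact congrArg (fun h => (Gr.map V S).p (V h)) (Gr.inverse_proj_graph S T y)
  have h2 : ∀ (S : (taut H).Base) (X : TangentSp S), Herm.Hom.fibDeriv (tautMap V) S X = 0 := by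
    intro S X
    rw [Herm.Hom.fibDeriv, h1, fderiv_const_apply]
    rfl
  intro ξ
  refine ContinuousLinearMap.ext fun v => ?_
  have h4 : tmap (Herm.Hom.total (tautMap V)) ξ v = _ :=
    Herm.Hom.tmap_total (tautMap V) ξ.1 ξ.2 (Herm.tbase v) (Herm.tfib v)
  have h5 : tmap (Herm.Hom.total (tautMap V)) ξ ((univConnection H).Φ ξ v) = _ :=
    Herm.Hom.tmap_total_vertical (tautMap V) ξ (Herm.tfib v)
  refine h5.trans (((univConnection H').apply_eq _ _).trans ?_).symm
  refine congrArg (Herm.tvec _ 0) ?_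
  refine (congrArg Herm.tfib h4).trans ?_
  rw [h2]
  exact add_zero _

/-! ### Universality -/

namespace Gr

variable {H H' : Hilb.{u}}

lemma param_map_subtype (V : H →ₗᵢ[ℂ] H') (S : Gr H) :
    Param (V.toContinuousLinearMap.comp S.1.subtypeL) (S.map V) := by
  refine ⟨V.injective.comp Subtype.val_injective, fun h => ⟨?_, ?_⟩⟩
  · rintro ⟨x, hx, rfl⟩
    exact ⟨⟨x, hx⟩, rfl⟩
  · rintro ⟨x, rfl⟩
    exact ⟨x, x.2, rfl⟩

lemma eventually_grChart_map {V : ℝ → H →ₗᵢ[ℂ] H'}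
    (hV : ContDiff ℝ ∞ fun t => (V t).toContinuousLinearMap) (S : Gr H) {S' : Gr H'}
    (h0 : S.map (V 0) = S') :
    ∀ᶠ t in nhds (0 : ℝ),
      (S'.p.comp ((V t).toContinuousLinearMap.comp S.1.subtypeL)).IsInvertible ∧
      grChart S' (S.map (V t)) = (S'.q.comp ((V t).toContinuousLinearMap.comp S.1.subtypeL)).comp
        (S'.p.comp ((V t).toContinuousLinearMap.comp S.1.subtypeL)).inverse := by
  have hJ : ContDiffOn ℝ ∞ (fun t => (V t).toContinuousLinearMap.comp S.1.subtypeL) Set.univ :=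
    hV.contDiffOn.complex_clm_comp contDiffOn_const
  have hA := contDiffOn_univ.1
    ((contDiffOn_const (c := S'.p)).complex_clm_comp hJ) |>.continuous
  have hi : (S'.p.comp ((V 0).toContinuousLinearMap.comp S.1.subtypeL)).IsInvertible := by
    refine ((param_map_subtype (V 0) S).mem_range_graph_iff S').1 ?_
    rw [h0]
    exact mem_source S'
  filter_upwards [hA.continuousAt.eventually (isOpen_invertible.mem_nhds hi)] with t ht
  exact ⟨ht, (param_map_subtype (V t) S).grChart_eq S' ht⟩

lemma differentiableAt_grChart_map {V : ℝ → H →ₗᵢ[ℂ] H'}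
    (hV : ContDiff ℝ ∞ fun t => (V t).toContinuousLinearMap) (S : Gr H) {S' : Gr H'}
    (h0 : S.map (V 0) = S') : DifferentiableAt ℝ (fun t => grChart S' (S.map (V t))) 0 := by
  have hev := eventually_grChart_map hV S h0
  obtain ⟨s, hs, hso, h0s⟩ := eventually_nhds_iff.1 hev
  have hJ : ContDiffOn ℝ ∞ (fun t => (V t).toContinuousLinearMap.comp S.1.subtypeL) s :=
    hV.contDiffOn.complex_clm_comp contDiffOn_const
  have h1 := ((contDiffOn_const (c := S'.q)).complex_clm_comp hJ).complex_clm_comp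
    (((contDiffOn_const (c := S'.p)).complex_clm_comp hJ).complex_clm_inverse
      fun t ht => (hs t ht).1)
  have h2 := (h1.contDiffAt (hso.mem_nhds h0s)).differentiableAt (by simp)
  exact h2.congr_of_eventuallyEq (hev.mono fun t ht => ht.2)

end Gr

section UniversalConnection

variable {H : Hilb.{u}}

lemma unitaryCurve_apply (u : unitary (H →L[ℂ] H)) (X : skewAdjoint (H →L[ℂ] H)) (t : ℝ) (h : H) :
    unitaryCurve u X t h = (u : H →L[ℂ] H) (NormedSpace.exp (t • (X : H →L[ℂ] H)) h) := rfl

lemma contDiff_unitaryCurve (u : unitary (H →L[ℂ] H)) (X : skewAdjoint (H →L[ℂ] H)) :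
    ContDiff ℝ ∞ fun t => (unitaryCurve u X t).toContinuousLinearMap := by
  have h1 : ContDiff ℝ ∞ fun t : ℝ => NormedSpace.exp (t • (X : H →L[ℂ] H)) := by
    refine contDiff_iff_contDiffAt.2 fun t => ?_
    have h2 : ContDiffAt ℝ ∞ (NormedSpace.exp : (H →L[ℂ] H) → (H →L[ℂ] H)) (t • (X : H →L[ℂ] H)) :=
      (NormedSpace.exp_analytic (𝕂 := ℝ) (t • (X : H →L[ℂ] H))).contDiffAt
    exact h2.comp t (contDiff_id.smul contDiff_const).contDiffAt
  exact contDiffOn_univ.1 ((contDiffOn_const (c := (u : H →L[ℂ] H))).complex_clm_comp h1.contDiffOn)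

lemma hasDerivAt_unitaryCurve (u : unitary (H →L[ℂ] H)) (X : skewAdjoint (H →L[ℂ] H)) (x y : H) :
    HasDerivAt (fun t : ℝ => unitaryCurve u X t (x + (t : ℂ) • y))
      ((u : H →L[ℂ] H) ((X : H →L[ℂ] H) x + y)) 0 := by
  have h1 : HasDerivAt (fun t : ℝ => NormedSpace.exp (t • (X : H →L[ℂ] H))) (X : H →L[ℂ] H) 0 := by
    simpa using hasDerivAt_exp_smul_const (𝕂 := ℝ) (X : H →L[ℂ] H) 0
  have h2 := (ContinuousLinearMap.restrictScalarsL ℂ H H ℝ ℝ).hasFDerivAt.comp_hasDerivAt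
    (0 : ℝ) h1
  have h3 : HasDerivAt (fun t : ℝ => x + (t : ℂ) • y) y 0 := by
    have := (((hasDerivAt_id (0 : ℝ)).smul_const y)).const_add x
    simpa using this
  have h4 := ((u : H →L[ℂ] H).restrictScalars ℝ).hasFDerivAt.comp_hasDerivAt (0 : ℝ)
    (h2.clm_apply h3)
  have e : (u : H →L[ℂ] H) ((X : H →L[ℂ] H) (x + ((0 : ℝ) : ℂ) • y) +
      NormedSpace.exp ((0 : ℝ) • (X : H →L[ℂ] H)) y) = (u : H →L[ℂ] H) ((X : H →L[ℂ] H) x + y) := by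
    simp [NormedSpace.exp_zero]
  rw [← e]
  exact h4

lemma map_unitaryCurve_zero (u : unitary (H →L[ℂ] H)) (S₀ : Gr H) (X : skewAdjoint (H →L[ℂ] H)) :
    S₀.map (unitaryCurve u X 0) =
      S₀.map (Unitary.linearIsometryEquiv u).toLinearIsometry := by
  have e : unitaryCurve u X 0 = (Unitary.linearIsometryEquiv u).toLinearIsometry := by
    ext h
    rw [unitaryCurve_apply, zero_smul, NormedSpace.exp_zero]
    rfl
  rw [e]

lemma deriv_prodMk_snd {E F : Type*} [NormedAddCommGroup E] [NormedSpace ℝ E]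
    [NormedAddCommGroup F] [NormedSpace ℝ F] {f : ℝ → E} {g : ℝ → F} {g' : F} {t : ℝ}
    (hf : DifferentiableAt ℝ f t) (hg : HasDerivAt g g' t) :
    (deriv (fun t => (f t, g t)) t).2 = g' :=
  congrArg Prod.snd (hf.hasDerivAt.prodMk hg).deriv

lemma deriv_prodMk_fst_eq_zero {E F : Type*} [NormedAddCommGroup E] [NormedSpace ℝ E]
    [NormedAddCommGroup F] [NormedSpace ℝ F] {f : ℝ → E} {g : ℝ → F} {g' : F} {t : ℝ} {c : E}
    (hf : f =ᶠ[nhds t] fun _ => c) (hg : HasDerivAt g g' t) :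
    (deriv (fun t => (f t, g t)) t).1 = 0 :=
  congrArg Prod.fst (((hasDerivAt_const t c).congr_of_eventuallyEq hf).prodMk hg).deriv

lemma hasDerivAt_p_unitaryCurve (u : unitary (H →L[ℂ] H)) (X : skewAdjoint (H →L[ℂ] H))
    (S' : Gr H) (x y : H) : HasDerivAt (fun t : ℝ => S'.p (unitaryCurve u X t (x + (t : ℂ) • y)))
      (S'.p ((u : H →L[ℂ] H) ((X : H →L[ℂ] H) x + y))) 0 :=
  (S'.p.restrictScalars ℝ).hasFDerivAt.comp_hasDerivAt (0 : ℝ) (hasDerivAt_unitaryCurve u X x y)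

lemma tfib_homTangent (u : unitary (H →L[ℂ] H)) (S₀ : Gr H) (X : skewAdjoint (H →L[ℂ] H))
    (x y : S₀.1) : Herm.tfib (homTangent u S₀ X x y) =
      (S₀.map (Unitary.linearIsometryEquiv u).toLinearIsometry).p
          ((u : H →L[ℂ] H) ((X : H →L[ℂ] H) x + y)) :=
  deriv_prodMk_snd (Gr.differentiableAt_grChart_map (contDiff_unitaryCurve u X) S₀
    (map_unitaryCurve_zero u S₀ X)) (hasDerivAt_p_unitaryCurve u X _ (x : H) (y : H))

/-- The operators `exp (t E_p X)` commute with `p`, so that the curves which they define in the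
Grassmann manifold are constant. -/
lemma tbase_homTangent_condExp (u : unitary (H →L[ℂ] H)) (S₀ : Gr H)
    (X : skewAdjoint (H →L[ℂ] H)) (x y : S₀.1) :
    Herm.tbase (homTangent u S₀ (condExp S₀ X) x y) = 0 := by
  set S' := S₀.map (Unitary.linearIsometryEquiv u).toLinearIsometry with hS'
  set P := S₀.1.starProjection with hP
  have hPP : P * P = P := S₀.1.isIdempotentElem_starProjection
  have hc : Commute P (condExp S₀ X : H →L[ℂ] H) := by
    change P * (P * X * P + (1 - P) * X * (1 - P)) = (P * X * P + (1 - P) * X * (1 - P)) * P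
    have h1 : P * (1 - P) = 0 := by rw [mul_sub, mul_one, hPP, sub_self]
    have h2 : (1 - P) * P = 0 := by rw [sub_mul, one_mul, hPP, sub_self]
    rw [mul_add, add_mul, mul_assoc _ (1 - P) P, h2, ← mul_assoc P ((1 - P) * _), ← mul_assoc P
      (1 - P), h1, mul_assoc (P * _) P P, hPP, ← mul_assoc P (P * _), ← mul_assoc P P, hPP]
    simp
  have h3 := Gr.eventually_grChart_map (contDiff_unitaryCurve u (condExp S₀ X)) S₀
    (map_unitaryCurve_zero u S₀ (condExp S₀ X))
  have h4 : (fun t => Gr.grChart S' (S₀.map (unitaryCurve u (condExp S₀ X) t))) =ᶠ[nhds 0]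
      fun _ => 0 := by
    filter_upwards [h3] with t ht
    rw [ht.2]
    have h5 : S'.q.comp ((unitaryCurve u (condExp S₀ X) t).toContinuousLinearMap.comp
        S₀.1.subtypeL) = 0 := by
      ext x : 1
      have hct : Commute P (NormedSpace.exp (t • (condExp S₀ X : H →L[ℂ] H))) :=
        (hc.smul_right t).exp_right
      have h6 : NormedSpace.exp (t • (condExp S₀ X : H →L[ℂ] H)) (x : H) ∈ S₀.1 := by
        have h7 := DFunLike.congr_fun hct (x : H)
        have h8 : P (x : H) = x := Submodule.starProjection_eq_self_iff.2 x.2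
        change P (NormedSpace.exp (t • (condExp S₀ X : H →L[ℂ] H)) (x : H)) =
          NormedSpace.exp (t • (condExp S₀ X : H →L[ℂ] H)) (P (x : H)) at h7
        rw [h8] at h7
        exact Submodule.starProjection_eq_self_iff.1 h7
      exact S'.q_coe_self ⟨_, ⟨_, h6, rfl⟩⟩
    rw [h5, ContinuousLinearMap.zero_comp]
  exact deriv_prodMk_fst_eq_zero h4 (hasDerivAt_p_unitaryCurve u _ S' (x : H) (y : H))

lemma isUniversal_univConnection (H : Hilb.{u}) : (univConnection H).IsUniversal := by
  intro u S₀ X x y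
  refine Prod.ext (tbase_homTangent_condExp u S₀ X x y).symm ?_
  refine (tfib_homTangent u S₀ X x y).trans (Eq.trans ?_
    (tfib_homTangent u S₀ (condExp S₀ X) x y).symm)
  set U := (Unitary.linearIsometryEquiv u).toLinearIsometry with hU
  set S' := S₀.map U with hS'
  set P := S₀.1.starProjection with hP
  have hx : P (x : H) = x := Submodule.starProjection_eq_self_iff.2 x.2
  have h1 : (condExp S₀ X : H →L[ℂ] H) (x : H) = P ((X : H →L[ℂ] H) x) := by
    change P ((X : H →L[ℂ] H) (P x)) +
      ((X : H →L[ℂ] H) ((x : H) - P x) - P ((X : H →L[ℂ] H) ((x : H) - P x))) = _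
    rw [hx]
    simp
  have h2 : ∀ h : H, S'.p ((u : H →L[ℂ] H) (P h)) = S'.p ((u : H →L[ℂ] H) h) := by
    intro h
    have h3 : (P h : H) + (S₀.q h : H) = h := S₀.add_eq h
    have h4 : (u : H →L[ℂ] H) (S₀.q h : H) ∈ S'.1ᗮ := by
      rintro _ ⟨z, hz, rfl⟩
      exact (U.inner_map_map z _).trans ((S₀.q h).2 z hz)
    conv_rhs => rw [← h3, map_add, map_add]
    rw [S'.p_coe_orthogonal ⟨_, h4⟩, add_zero]
  change S'.p ((u : H →L[ℂ] H) ((X : H →L[ℂ] H) x + y)) =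
    S'.p ((u : H →L[ℂ] H) ((condExp S₀ X : H →L[ℂ] H) x + y))
  rw [h1, map_add, map_add, map_add, map_add, h2]

end UniversalConnection

/-! ### The reproducing kernel Hilbert space -/

namespace PosDefKernel

variable {D : Herm.{u}} (K : PosDefKernel D)

/-- The restriction of `ξ ↦ K_ξ` to the fiber over `s`. -/
def fiberHat (s : D.Base) (x : D.Fiber s) : K.rkhs := K.hat ⟨s, x⟩

lemma inner_fiberHat (s t : D.Base) (y : D.Fiber s) (x : D.Fiber t) :
    inner ℂ (K.fiberHat s y) (K.fiberHat t x) = inner ℂ y (K.ker s t x) :=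
  K.inner_hat ⟨s, y⟩ ⟨t, x⟩

lemma fiberHat_eq_of_inner {s : D.Base} {x : D.Fiber s} {a : K.rkhs}
    (h1 : ∀ t y, inner ℂ (K.fiberHat t y) (K.fiberHat s x) = inner ℂ (K.fiberHat t y) a)
    (h2 : ∀ v, (∀ t y, inner ℂ (K.fiberHat t y) v = 0) → inner ℂ a v = 0) :
    K.fiberHat s x = a := by
  have h3 : ∀ t y, inner ℂ (K.fiberHat t y) (K.fiberHat s x - a) = 0 := fun t y => by
    rw [inner_sub_right, h1, sub_self]
  rw [← sub_eq_zero, ← inner_self_eq_zero (𝕜 := ℂ), inner_sub_left, h3, h2 _ h3, sub_self]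

lemma fiberHat_add (s : D.Base) (x y : D.Fiber s) :
    K.fiberHat s (x + y) = K.fiberHat s x + K.fiberHat s y := by
  refine K.fiberHat_eq_of_inner (fun t z => ?_) fun v hv => ?_
  · rw [inner_add_right, inner_fiberHat, inner_fiberHat, inner_fiberHat, ← inner_add_right,
      ← map_add]
  · rw [inner_add_left, hv, hv, add_zero]

lemma fiberHat_smul (s : D.Base) (c : ℂ) (x : D.Fiber s) :
    K.fiberHat s (c • x) = c • K.fiberHat s x := by
  refine K.fiberHat_eq_of_inner (fun t z => ?_) fun v hv => ?_
  · rw [inner_smul_right, inner_fiberHat, inner_fiberHat, ← inner_smul_right, ← map_smul]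
  · rw [inner_smul_left, hv, mul_zero]

/-- The bounded operator `ξ ↦ K_ξ` on the fiber over `s`. -/
def hatLinear (s : D.Base) : D.Fiber s →L[ℂ] K.rkhs :=
  LinearMap.mkContinuous
    { toFun := K.fiberHat s
      map_add' := K.fiberHat_add s
      map_smul' := K.fiberHat_smul s } (Real.sqrt ‖K.ker s s‖) fun x => by
    have h1 : ‖K.fiberHat s x‖ ^ 2 ≤ ‖K.ker s s‖ * ‖x‖ ^ 2 := by
      rw [← inner_self_eq_norm_sq (𝕜 := ℂ), inner_fiberHat]
      refine (RCLike.re_le_norm _).trans ((norm_inner_le_norm _ _).trans ?_)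
      calc ‖x‖ * ‖K.ker s s x‖ ≤ ‖x‖ * (‖K.ker s s‖ * ‖x‖) := by
            gcongr
            exact (K.ker s s).le_opNorm x
        _ = ‖K.ker s s‖ * ‖x‖ ^ 2 := by ring
    have h2 := Real.sqrt_le_sqrt h1
    rwa [Real.sqrt_sq (norm_nonneg _), Real.sqrt_mul (norm_nonneg _),
      Real.sqrt_sq (norm_nonneg _)] at h2

lemma hatLinear_apply (s : D.Base) (x : D.Fiber s) : K.hatLinear s x = K.fiberHat s x := rfl

lemma adjoint_hatLinear_fiberHat (s t : D.Base) (x : D.Fiber t) :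
    ContinuousLinearMap.adjoint (K.hatLinear s) (K.fiberHat t x) = K.ker s t x :=
  ext_inner_left ℂ fun y => by
    rw [ContinuousLinearMap.adjoint_inner_right, hatLinear_apply, inner_fiberHat]

/-- The restriction of `ξ ↦ K_ξ` to the fiber over `s` is bounded below, because the composition
of its adjoint with it is the invertible operator `K(s, s)`. -/
lemma exists_antilipschitz_hatLinear {s : D.Base} (h : (K.ker s s).IsInvertible) :
    ∃ c, AntilipschitzWith c (K.hatLinear s) := by
  obtain ⟨e, he⟩ := h
  have h1 : ∀ x : D.Fiber s,
      e.symm (ContinuousLinearMap.adjoint (K.hatLinear s) (K.hatLinear s x)) = x := fun x => by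
    rw [hatLinear_apply, adjoint_hatLinear_fiberHat, ← he]
    exact e.symm_apply_apply x
  exact ⟨_, ((e.symm : D.Fiber s →L[ℂ] D.Fiber s).comp
    (ContinuousLinearMap.adjoint (K.hatLinear s))).lipschitz.to_rightInverse h1⟩

lemma param_hatLinear {s : D.Base} (h : (K.ker s s).IsInvertible) :
    Gr.Param (K.hatLinear s) (K.zeta s) := by
  obtain ⟨c, hc⟩ := K.exists_antilipschitz_hatLinear h
  refine ⟨hc.injective, fun v => ?_⟩
  have h1 : IsClosed ((LinearMap.range (K.hatLinear s : D.Fiber s →ₗ[ℂ] K.rkhs) :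
      Submodule ℂ K.rkhs) : Set K.rkhs) :=
    hc.isClosed_range (K.hatLinear s).uniformContinuous
  have h2 : Submodule.span ℂ (Set.range fun x : D.Fiber s => K.hat ⟨s, x⟩) =
      LinearMap.range (K.hatLinear s : D.Fiber s →ₗ[ℂ] K.rkhs) := by
    conv_rhs => rw [← Submodule.span_eq (LinearMap.range (K.hatLinear s : D.Fiber s →ₗ[ℂ] K.rkhs))]
    rfl
  change v ∈ (Submodule.span ℂ
    (Set.range fun x : D.Fiber s => K.hat ⟨s, x⟩)).topologicalClosure ↔ _
  rw [h2, h1.submodule_topologicalClosure_eq]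
  rfl

lemma inner_linearCombination {F : Type u} [NormedAddCommGroup F] [InnerProductSpace ℂ F]
    {j : D.Total → F} (hj : ∀ η ξ, inner ℂ (j η) (j ξ) = K.form η ξ) (f g : D.Total →₀ ℂ) :
    inner ℂ (Finsupp.linearCombination ℂ j f) (Finsupp.linearCombination ℂ j g) =
      K.sesq f g := by
  rw [sesq_eq, Finsupp.linearCombination_apply, Finsupp.linearCombination_apply, Finsupp.sum,
    Finsupp.sum, sum_inner]
  refine Finset.sum_congr rfl fun η _ => ?_
  rw [inner_sum]
  refine Finset.sum_congr rfl fun ξ _ => ?_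
  rw [inner_smul_left, inner_smul_right, hj, starRingEnd_apply, mul_assoc]

/-- The universal property of `ℋ^K`: a family of vectors with the Gram matrix of the sections
`K_ξ` is the image of these sections under a linear isometry. -/
lemma exists_isometry {F : Hilb.{u}} (j : D.Total → F)
    (hj : ∀ η ξ, inner ℂ (j η) (j ξ) = inner ℂ η.2 (K.ker η.1 ξ.1 ξ.2)) :
    ∃ V : K.rkhs →ₗᵢ[ℂ] F, ∀ ξ, V (K.hat ξ) = j ξ := by
  let L : K.Pre →ₗ[ℂ] F := Finsupp.linearCombination ℂ j
  have hL : ∀ f : K.Pre, ‖L f‖ = ‖f‖ := fun f => by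
    have h1 : inner ℂ (L f) (L f) = inner ℂ f f := K.inner_linearCombination hj f f
    rw [@norm_eq_sqrt_re_inner ℂ, @norm_eq_sqrt_re_inner ℂ _ _ _ _ f, h1]
  let L₁ : K.Pre →L[ℂ] F := L.mkContinuous 1 fun f => by rw [one_mul, hL]
  let i : K.Pre →L[ℂ] UniformSpace.Completion K.Pre := UniformSpace.Completion.toComplL
  have hi : DenseRange i := UniformSpace.Completion.denseRange_coe
  have hiu : IsUniformInducing i := UniformSpace.Completion.isUniformInducing_coe K.Pre
  let V₀ : UniformSpace.Completion K.Pre →L[ℂ] F := L₁.extend i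
  have hV₀ : ∀ f : K.Pre, V₀ (f : UniformSpace.Completion K.Pre) = L f := fun f =>
    ContinuousLinearMap.extend_eq L₁ hi hiu f
  refine ⟨⟨V₀.toLinearMap, fun v => ?_⟩, fun ξ => ?_⟩
  · refine UniformSpace.Completion.induction_on
      (p := fun v : UniformSpace.Completion K.Pre => ‖V₀ v‖ = ‖v‖) v
      (isClosed_eq V₀.continuous.norm continuous_norm) fun f => ?_
    rw [hV₀, UniformSpace.Completion.norm_coe, hL]
  · refine (hV₀ _).trans ?_
    refine (Finsupp.linearCombination_single ℂ (1 : ℂ) ξ).trans (one_smul ℂ _)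

end PosDefKernel

lemma Gr.Param.eq {H : Hilb.{u}} {E : Type u} [NormedAddCommGroup E] [NormedSpace ℂ E]
    {J : E →L[ℂ] H} {W W' : Gr H} (h : Gr.Param J W) (h' : Gr.Param J W') : W = W' := by
  apply Gr.ext
  ext v
  rw [h.2, h'.2]

/-! ### The universal kernel -/

section UniversalKernel

variable (H : Hilb.{u})

lemma inner_univKernel (S₁ S₂ : Gr H) (y : S₁.1) (x : S₂.1) :
    inner ℂ y (S₁.proj S₂ x) = inner ℂ (y : H) (x : H) :=
  Submodule.inner_orthogonalProjectionOnto_eq_of_mem_left y (x : H)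

lemma isSmoothKernel_univKernel : (univKernel H).IsSmoothKernel := by
  have key : ∀ S S' S₁ S₂ : Gr H, ContDiffOn ℝ ∞
      (fun r : (S₁.1 →L[ℂ] S₁.1ᗮ) × (S₂.1 →L[ℂ] S₂.1ᗮ) =>
        (S.proj (S₁.graph r.1)).comp (((S₁.graph r.1).proj (S₂.graph r.2)).comp
          (S'.proj (S₂.graph r.2)).inverse))
      (Set.univ ×ˢ {T | S₂.graph T ∈ Set.range S'.graph}) := by
    intro S S' S₁ S₂
    have h1 : ContDiffOn ℝ ∞ (fun r : (S₁.1 →L[ℂ] S₁.1ᗮ) × (S₂.1 →L[ℂ] S₂.1ᗮ) =>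
        (S₁.graph r.1).1.subtypeL.comp (S₁.graph r.1).p)
        (Set.univ ×ˢ {T | S₂.graph T ∈ Set.range S'.graph}) :=
      (S₁.contDiff_starProjection_graph.comp contDiff_fst).contDiffOn
    have h2 : ContDiffOn ℝ ∞ (fun r : (S₁.1 →L[ℂ] S₁.1ᗮ) × (S₂.1 →L[ℂ] S₂.1ᗮ) => S₂.jmap r.2)
        (Set.univ ×ˢ {T | S₂.graph T ∈ Set.range S'.graph}) :=
      ((S₂.contDiff_jmap.restrict_scalars ℝ).comp contDiff_snd).contDiffOn
    have h3 := (contDiffOn_const (c := S.p)).complex_clm_comp (h1.complex_clm_comp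
      (h2.complex_clm_comp (((contDiffOn_const (c := S'.p)).complex_clm_comp
        h2).complex_clm_inverse fun r hr => Gr.invertible_of_mem hr.2)))
    refine h3.congr fun r hr => ?_
    rw [← (Gr.param_jmap S₂ r.2).comp_inverse_proj S' (Gr.invertible_of_mem hr.2)]
    rfl
  intro S S' S₁ S₂
  exact (key S S' S₁ S₂).mono fun r hr => ⟨trivial, hr.2.2⟩

/-- The reproducing kernel Hilbert space of the universal kernel is `H` itself: the sections
`Q_{(S, x)}` are the images of the vectors `x` under a linear isometry. -/
lemma exists_isometry_rkhs_univKernel :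
    ∃ V : H →ₗᵢ[ℂ] (univKernel H).rkhs, ∀ ξ, (univKernel H).hat ξ = V (tautVec ξ) := by
  obtain ⟨V, hV⟩ := (univKernel H).exists_isometry (F := H) tautVec fun η ξ =>
    (inner_univKernel H η.1 ξ.1 η.2 ξ.2).symm
  have hs : Function.Surjective V := fun h =>
    ⟨(univKernel H).hat (tautPoint ⟨⊤, isClosed_univ⟩ ⟨h, trivial⟩), hV _⟩
  refine ⟨(LinearIsometryEquiv.ofSurjective V hs).symm.toLinearIsometry, fun ξ => ?_⟩
  refine ((LinearIsometryEquiv.ofSurjective V hs).symm_apply_eq.2 ?_).symm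
  exact (hV ξ).symm

lemma isInvertible_univKernel (S : Gr H) : (S.proj S).IsInvertible := by
  refine ⟨ContinuousLinearEquiv.refl ℂ S.1, ?_⟩
  ext x : 1
  exact (S.p_coe x).symm

lemma isAdmissible_univKernel : (univKernel H).IsAdmissible where
  isSmoothKernel := isSmoothKernel_univKernel H
  isInvertible := isInvertible_univKernel H
  isSmooth_zeta := by
    obtain ⟨V, hV⟩ := exists_isometry_rkhs_univKernel H
    have h : (univKernel H).zeta = Gr.map V := by
      funext S
      have h1 := (univKernel H).param_hatLinear (isInvertible_univKernel H S)
      have h2 : (univKernel H).hatLinear S =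
          V.toContinuousLinearMap.comp (Gr.toSubmodule S).subtypeL :=
        ContinuousLinearMap.ext fun x => hV ⟨S, x⟩
      rw [h2] at h1
      exact h1.eq (Gr.param_map_subtype V S)
    rw [h]
    exact Herm.Hom.isSmooth_base (tautMap V)

end UniversalKernel

/-! ### The classifying morphism of an admissible kernel -/

/-- A morphism to a universal bundle is determined by the vectors `x` of its values `(S, x)`,
because these vectors exhaust the subspaces `S`. -/
lemma Herm.Hom.ext_tautVec {D : Herm.{u}} {H : Hilb.{u}} {Θ Θ' : D ⟶ taut H}
    (h : ∀ ξ, tautVec (Herm.Hom.total Θ ξ) = tautVec (Herm.Hom.total Θ' ξ)) : Θ = Θ' := by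
  have hb : ∀ (Θ : D ⟶ taut H) (s : D.Base) (v : H), v ∈ (Gr.toSubmodule (Herm.Hom.base Θ s)) ↔
      ∃ x, tautVec (Herm.Hom.total Θ ⟨s, x⟩) = v := by
    intro Θ s v
    constructor
    · intro hv
      obtain ⟨x, hx⟩ := (Herm.Hom.fib Θ s).surjective ⟨v, hv⟩
      exact ⟨x, congrArg Subtype.val hx⟩
    · rintro ⟨x, rfl⟩
      exact (Herm.Hom.fib Θ s x).2
  refine Herm.Hom.ext_total (funext fun ξ => taut_ext ?_ (h ξ))
  apply Gr.ext
  ext v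
  refine (hb Θ ξ.1 v).trans (Iff.trans ?_ (hb Θ' ξ.1 v).symm)
  exact exists_congr fun x => (congrArg (· = v) (h ⟨ξ.1, x⟩)).to_iff

namespace PosDefKernel

variable {D : Herm.{u}} {K : PosDefKernel D}

/-- The component of the classifying morphism on the fibers is smooth: on the subspace
`ζ_K z`, the projection of `K_ξ` is determined by `K(z, ·) ξ`. -/
lemma IsAdmissible.contDiffOn_p_hatLinear (hK : K.IsAdmissible) (z : D.Base) :
    ContDiffOn ℝ ∞ (fun p : Model z => (K.zeta z).p.comp
      ((K.hatLinear ((chart z).symm p)).comp (D.triv z ((chart z).symm p)).inverse))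
      (chartImage z (D.dom z)) := by
  obtain ⟨e, -, he⟩ := (K.param_hatLinear (hK.isInvertible z)).adjoint_comp_self_eq
  have hm : chart z z ∈ chartImage z (D.dom z) := chart_mem_chartImage z _ (D.mem_dom z)
  have h1 := (hK.isSmoothKernel z z z z).comp (f := fun p : Model z => (chart z z, p))
    (s := chartImage z (D.dom z)) (contDiff_const.prodMk contDiff_id).contDiffOn
    fun p hp => ⟨hm, hp⟩
  have h2 := (contDiffOn_const (c := (ContinuousLinearMap.adjoint
    (e : D.Fiber z →L[ℂ] (K.zeta z).1)).inverse)).complex_clm_comp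
      ((contDiffOn_const (c := (D.triv z z).inverse)).complex_clm_comp h1)
  refine h2.congr fun p hp => ?_
  ext x : 1
  have h3 : (chart z).symm (chart z z) = z := (chart z).left_inv (mem_source z)
  simp only [Function.comp_apply, ContinuousLinearMap.comp_apply]
  set s := (chart z).symm p
  set w := (D.triv z s).inverse x
  -- the fibers depend on the point, so that `h3` is applied to a variable point
  have h4 : ∀ z', z' = z → (D.triv z z').comp ((K.ker z' s).comp (D.triv z s).inverse) x =
      D.triv z z (K.ker z s w) := by
    rintro _ rfl
    rfl
  refine Eq.trans ?_ (congrArg (fun w => (ContinuousLinearMap.adjoint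
    (e : D.Fiber z →L[ℂ] (K.zeta z).1)).inverse ((D.triv z z).inverse w)) (h4 _ h3).symm)
  rw [(D.triv_invertible z z (D.mem_dom z)).inverse_apply_self, eq_comm,
    (Gr.isInvertible_adjoint e).inverse_apply_eq]
  exact (K.adjoint_hatLinear_fiberHat z s w).symm.trans (DFunLike.congr_fun he _)

/-- The classifying morphism on the fiber over `s`, an invertible operator from `D_s` onto
`ζ_K s`. -/
def classifyingFib (hK : K.IsAdmissible) (s : D.Base) : D.Fiber s ≃L[ℂ] (K.zeta s).1 :=
  (K.param_hatLinear (hK.isInvertible s)).equiv.choose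

lemma coe_classifyingFib (hK : K.IsAdmissible) (s : D.Base) (x : D.Fiber s) :
    (classifyingFib hK s x : K.rkhs) = K.fiberHat s x :=
  (K.param_hatLinear (hK.isInvertible s)).equiv.choose_spec x

lemma isSmooth_classifying (hK : K.IsAdmissible) :
    IsSmooth (Herm.totalMap (D' := taut K.rkhs) K.zeta (classifyingFib hK)) := by
  have hU : ∀ z : D.Base, IsOpen (chartImage z (D.dom z) ∩
      chartImage z (K.zeta ⁻¹' (chart (K.zeta z)).source)) := fun z =>
    (D.isOpenSet_dom z z).inter (hK.isSmooth_zeta z (K.zeta z)).1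
  have hUm : ∀ z : D.Base, chart z z ∈ chartImage z (D.dom z) ∩
      chartImage z (K.zeta ⁻¹' (chart (K.zeta z)).source) := fun z =>
    ⟨chart_mem_chartImage z _ (D.mem_dom z), chart_mem_chartImage z _ (mem_source (K.zeta z))⟩
  refine isSmooth_of_forall_contDiffAt (fun ξ => ?_) (fun ξ => ?_)
  · refine Filter.mem_of_superset (((hU ξ.1).prod isOpen_univ).mem_nhds
      (⟨hUm ξ.1, trivial⟩ : (chart ξ.1 ξ.1, D.triv ξ.1 ξ.1 ξ.2) ∈
        _ ×ˢ (Set.univ : Set (D.Fiber ξ.1)))) ?_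
    rintro ⟨p, x⟩ ⟨⟨h1, h2⟩, -⟩
    exact ⟨⟨h1, trivial⟩, h2.2, h2.2⟩
  · obtain ⟨z, x₀⟩ := ξ
    have h1 : ContDiffOn ℝ ∞ (fun q : Model z × D.Fiber z =>
        (localRep K.zeta z (K.zeta z) q.1, (K.zeta z).p.comp
          ((K.hatLinear ((chart z).symm q.1)).comp (D.triv z ((chart z).symm q.1)).inverse) q.2))
        ((chartImage z (D.dom z) ∩ chartImage z (K.zeta ⁻¹' (chart (K.zeta z)).source)) ×ˢ
          Set.univ) :=
      ((hK.isSmooth_zeta z (K.zeta z)).2.comp contDiffOn_fst fun q hq => hq.1.2).prodMk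
        (((hK.contDiffOn_p_hatLinear z).comp contDiffOn_fst fun q hq =>
          hq.1.1).complex_clm_apply contDiffOn_snd)
    have h2 := h1.contDiffAt (((hU z).prod isOpen_univ).mem_nhds
      (⟨hUm z, trivial⟩ : (chart z z, D.triv z z x₀) ∈ _ ×ˢ (Set.univ : Set (D.Fiber z))))
    refine h2.congr_of_eventuallyEq (Filter.Eventually.of_forall fun q => ?_)
    exact Prod.ext rfl (congrArg (K.zeta z).p (coe_classifyingFib hK _ _))

/-- The classifying morphism `Δ_K` of an admissible kernel. -/
def classifying (hK : K.IsAdmissible) : D ⟶ taut K.rkhs where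
  base := K.zeta
  fib := classifyingFib hK
  isSmooth_base := hK.isSmooth_zeta
  isSmooth_total := isSmooth_classifying hK

lemma isClassifying_classifying (hK : K.IsAdmissible) : K.IsClassifying (classifying hK) :=
  fun ξ => ⟨rfl, coe_classifyingFib hK ξ.1 ξ.2⟩

lemma tautVec_classifying (hK : K.IsAdmissible) (ξ : D.Total) :
    tautVec (Herm.Hom.total (classifying hK) ξ) = K.hat ξ :=
  (isClassifying_classifying hK ξ).2

/-- Every admissible kernel is the pull-back of a universal kernel. -/
lemma isPullbackKernel_classifying (hK : K.IsAdmissible) :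
    IsPullbackKernel (classifying hK) K (univKernel K.rkhs) := by
  refine (isPullbackKernel_iff _ _ _).2 fun s t y x => ?_
  refine Eq.trans ?_ (inner_univKernel K.rkhs (K.zeta s) (K.zeta t) (classifyingFib hK s y)
    (classifyingFib hK t x)).symm
  rw [coe_classifyingFib, coe_classifyingFib, inner_fiberHat]

/-- The classifying morphisms are natural up to linear isometries. -/
lemma exists_classifying_comp_tautMap {D' : Herm.{u}} {K' : PosDefKernel D'}
    (hK : K.IsAdmissible) (hK' : K'.IsAdmissible) {Θ : D ⟶ D'} (h : IsPullbackKernel Θ K K') :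
    ∃ V : K.rkhs →ₗᵢ[ℂ] K'.rkhs, classifying hK ≫ tautMap V = Θ ≫ classifying hK' := by
  obtain ⟨V, hV⟩ := K.exists_isometry (F := K'.rkhs) (fun ξ => K'.hat (Herm.Hom.total Θ ξ))
    fun η ξ => (K'.inner_hat _ _).trans
      ((isPullbackKernel_iff Θ K K').1 h η.1 ξ.1 η.2 ξ.2).symm
  refine ⟨V, Herm.Hom.ext_tautVec fun ξ => ?_⟩
  exact (congrArg V (tautVec_classifying hK ξ)).trans
    ((hV ξ).trans (tautVec_classifying hK' (Herm.Hom.total Θ ξ)).symm)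

end PosDefKernel

lemma exists_classifying_univKernel_eq (H : Hilb.{u}) :
    ∃ V : H →ₗᵢ[ℂ] (univKernel H).rkhs,
      PosDefKernel.classifying (isAdmissible_univKernel H) = tautMap V := by
  obtain ⟨V, hV⟩ := exists_isometry_rkhs_univKernel H
  exact ⟨V, Herm.Hom.ext_tautVec fun ξ =>
    (PosDefKernel.tautVec_classifying _ ξ).trans (hV ξ)⟩

lemma isPullbackKernel_tautMap {H H' : Hilb.{u}} (V : H →ₗᵢ[ℂ] H') :
    IsPullbackKernel (tautMap V) (univKernel H) (univKernel H') := by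
  refine (isPullbackKernel_iff _ _ _).2 fun (S T : Gr H) (y : S.1) (x : T.1) => ?_
  refine (inner_univKernel H S T y x).trans (Eq.trans ?_
    (inner_univKernel H' (S.map V) (T.map V) (S.mapFib V y) (T.mapFib V x)).symm)
  exact (V.inner_map_map _ _).symm

/-! ### The functors -/

/-- Functors to the category of linear connections are equal if they agree on the objects and on
the underlying bundle morphisms. -/
lemma LinConnect.functor_ext {C : Type*} [Category* C] {F G : C ⥤ LinConnect.{u}}
    (h : F ⋙ LinConnect.forget = G ⋙ LinConnect.forget) (ho : ∀ X, F.obj X = G.obj X) : F = G := by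
  refine CategoryTheory.Functor.ext ho fun X Y f => ?_
  have hf := Functor.congr_hom h f
  have hinj : ∀ {A B : LinConnect.{u}} {f g : A ⟶ B},
      LinConnect.forget.map f = LinConnect.forget.map g → f = g := fun h => LinConnect.Hom.ext h
  apply hinj
  simpa [eqToHom_map] using hf

/-- The functor of universal kernels. -/
def univKernelFunctor : Hilb.{u} ⥤ Kernh.{u} where
  obj H := ⟨taut H, univKernel H, isAdmissible_univKernel H⟩
  map V := ⟨tautMap V, isPullbackKernel_tautMap V⟩
  map_id H := Kernh.Hom.ext (tautFunctor.map_id H)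
  map_comp V W := Kernh.Hom.ext (tautFunctor.map_comp V W)

/-- The functor of universal connections. -/
def univConnectionFunctor : Hilb.{u} ⥤ LinConnect.{u} where
  obj H := ⟨taut H, univConnection H⟩
  map V := ⟨tautMap V, isPullbackConnection_tautMap V⟩
  map_id H := LinConnect.Hom.ext (tautFunctor.map_id H)
  map_comp V W := LinConnect.Hom.ext (tautFunctor.map_comp V W)

namespace Kernh

/-- The linear connection `Φ_K` associated with an admissible kernel: the pull-back of the
universal connection through the classifying morphism. -/
def connection (K : Kernh.{u}) : LinearConnection K.bundle :=
  LinearConnection.pullback (PosDefKernel.classifying K.admissible)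
    (univConnection K.kernel.rkhs)

lemma isPullbackConnection_classifying (K : Kernh.{u}) :
    IsPullbackConnection (PosDefKernel.classifying K.admissible) K.connection
      (univConnection K.kernel.rkhs) :=
  LinearConnection.isPullbackConnection_pullback _ _

/-- Both sides are pull-backs of a universal connection through the same morphism. -/
lemma isPullbackConnection_connection {K K' : Kernh.{u}} {Θ : K.bundle ⟶ K'.bundle}
    (h : IsPullbackKernel Θ K.kernel K'.kernel) :
    IsPullbackConnection Θ K.connection K'.connection := by
  obtain ⟨V, hV⟩ := PosDefKernel.exists_classifying_comp_tautMap K.admissible K'.admissible h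
  have h1 := LinearConnection.isPullbackConnection_comp K.isPullbackConnection_classifying
    (isPullbackConnection_tautMap V)
  have h2 := LinearConnection.isPullbackConnection_pullback Θ K'.connection
  have h3 := LinearConnection.isPullbackConnection_comp h2 K'.isPullbackConnection_classifying
  rw [hV] at h1
  rw [LinearConnection.isPullbackConnection_unique h1 h3]
  exact h2

/-- The functor which maps an admissible kernel to its linear connection. -/
def connectionFunctor : Kernh.{u} ⥤ LinConnect.{u} where
  obj K := ⟨K.bundle, K.connection⟩
  map Θ := ⟨Θ.hom, isPullbackConnection_connection Θ.pullback⟩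
  map_id _ := rfl
  map_comp _ _ := rfl

lemma connection_univKernel (H : Hilb.{u}) :
    connection ⟨taut H, univKernel H, isAdmissible_univKernel H⟩ = univConnection H := by
  obtain ⟨V, hV⟩ := exists_classifying_univKernel_eq H
  have h1 := isPullbackConnection_classifying ⟨taut H, univKernel H, isAdmissible_univKernel H⟩
  rw [hV] at h1
  exact LinearConnection.isPullbackConnection_unique h1 (isPullbackConnection_tautMap V)

end Kernh

lemma univKernelFunctor_comp_connectionFunctor :
    univKernelFunctor.{u} ⋙ Kernh.connectionFunctor = univConnectionFunctor :=
  LinConnect.functor_ext rfl fun H =>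
    congrArg (LinConnect.mk (taut H)) (Kernh.connection_univKernel H)

lemma LinConnect.eq_of_hom {C C' : LinConnect.{u}} (m : C ⟶ C') {D D' : Herm.{u}}
    {Φ : LinearConnection D} {Φ' : LinearConnection D'} {Θ : D ⟶ D'}
    (hΦ : IsPullbackConnection Θ Φ Φ') (hC : C.bundle = D) (hC' : C' = ⟨D', Φ'⟩)
    (hm : m.hom = eqToHom hC ≫ Θ ≫ eqToHom (congrArg LinConnect.bundle hC').symm) :
    C = ⟨D, Φ⟩ := by
  subst hC'
  obtain ⟨D₀, Ψ⟩ := C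
  obtain rfl : D₀ = D := hC
  have h1 : m.hom = Θ := by simpa using hm
  have h2 := m.pullback
  rw [h1] at h2
  exact congrArg (LinConnect.mk D₀) (LinearConnection.isPullbackConnection_unique h2 hΦ)

/-- Uniqueness: the classifying morphism of `K` is a morphism of kernels to a universal kernel,
so that the value at `K` is a pull-back of a universal connection. -/
lemma Kernh.eq_connectionFunctor {B : Kernh.{u} ⥤ LinConnect.{u}}
    (h1 : B ⋙ LinConnect.forget = Kernh.forget)
    (h2 : univKernelFunctor ⋙ B = univConnectionFunctor) : B = Kernh.connectionFunctor := by
  refine LinConnect.functor_ext h1 fun K => ?_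
  let Δ : K ⟶ univKernelFunctor.obj K.kernel.rkhs :=
    ⟨PosDefKernel.classifying K.admissible, PosDefKernel.isPullbackKernel_classifying K.admissible⟩
  exact LinConnect.eq_of_hom (B.map Δ) K.isPullbackConnection_classifying
    (Functor.congr_obj h1 K) (Functor.congr_obj h2 K.kernel.rkhs) (Functor.congr_hom h1 Δ)

end

theorem theorem4p3 :
    ∃ (hQ : ∀ H : Hilb.{u}, (univKernel H).IsAdmissible)
      (φ : ∀ H : Hilb.{u}, LinearConnection (taut H))
      (Q : Hilb.{u} ⥤ Kernh.{u}) (Φ : Hilb.{u} ⥤ LinConnect.{u})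
      (A : Kernh.{u} ⥤ LinConnect.{u}),
      -- `φ H` is the universal connection on the universal bundle of `H`
      (∀ H, (φ H).IsUniversal) ∧
      -- `Q` is the functor of universal kernels
      (Q ⋙ Kernh.forget = tautFunctor ∧ ∀ H, Q.obj H = ⟨taut H, univKernel H, hQ H⟩) ∧
      -- `Φ` is the functor of universal connections
      (Φ ⋙ LinConnect.forget = tautFunctor ∧ ∀ H, Φ.obj H = ⟨taut H, φ H⟩) ∧
      -- `A` maps a kernel to the pull-back of the universal connection by the classifying morphism
      (∀ K : Kernh.{u}, ∃ (Δ : K.bundle ⟶ taut K.kernel.rkhs) (ψ : LinearConnection K.bundle),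
        K.kernel.IsClassifying Δ ∧ IsPullbackConnection Δ ψ (φ K.kernel.rkhs) ∧
        A.obj K = ⟨K.bundle, ψ⟩) ∧
      -- the diagram commutes for `A`, and `A` is the only functor for which it does
      A ⋙ LinConnect.forget = Kernh.forget ∧ Q ⋙ A = Φ ∧
      ∀ B : Kernh.{u} ⥤ LinConnect.{u},
        B ⋙ LinConnect.forget = Kernh.forget → Q ⋙ B = Φ → B = A := by
  refine ⟨isAdmissible_univKernel, univConnection, univKernelFunctor, univConnectionFunctor,
    Kernh.connectionFunctor, isUniversal_univConnection, ⟨rfl, fun _ => rfl⟩, ⟨rfl, fun _ => rfl⟩,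
    fun K => ⟨PosDefKernel.classifying K.admissible, K.connection,
      PosDefKernel.isClassifying_classifying K.admissible, K.isPullbackConnection_classifying,
      rfl⟩, rfl, univKernelFunctor_comp_connectionFunctor, fun B h1 h2 =>
        Kernh.eq_connectionFunctor h1 h2⟩
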